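/- Let $p_n = 2^{-n}$ and let $\Omega=\bigcup_{n\ge 0}[n,n+1]\times[0,p_n]$ be the table of the exponential step billiard. For $\alpha>0$ let $R_\alpha$ be the invariant surface of the billiard in direction $(1,\alpha)$, obtained by unfolding: in the plane it is the union over $n\ge 0$ of the columns $[n,n+1]\times[-p_n,p_n]$ and $[-n-1,-n]\times[-p_n,p_n]$, where the top and bottom sides of each column are identified by vertical translation, and each point $(n,Y)$, $n\ge 1$, $p_n\le |Y|\le p_{n-1}$, of a right wall is identified with $(-n,Y)$, the corners being treated so that the flow is continuous from above (an orbit reaching $(n,p_n)$ continues from $(-n,p_n)$, an orbit reaching $(-n,p_n)$ from the left continues from $(-n,-p_n)$, and an orbit reaching $(n,-p_n)$ passes through). Let $\phi_\alpha^t$, $t\in\mathbb R$, be the flow on $R_\alpha$ that moves points with unit speed in direction $(1,\alpha)$; $(X,Y)\mapsto(|X|,|Y|)$ projects it onto the billiard motion in $\Omega$. An orbit of $\phi_\alpha^t$ is an escape orbit if, from some time on, its projection to $\Omega$ moves with constant positive horizontal velocity (so that it hits no vertical wall any more and goes to infinity). Its backward semi-orbit escapes if, for all times before some time, the projection moves with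 constant negative horizontal velocity; the orbit is oscillating in the past if its backward semi-orbits are unbounded but do not escape. Then for (Lebesgue-)almost every $\alpha>0$ there is exactly one escape orbit in $R_\alpha$, and this orbit is oscillating in the past. -/

import Mathlib

open MeasureTheory Set

noncomputable section

namespace StepBilliard

/-- The heights `p n = 2 ^ (-n)` of the exponential step billiard. -/
def p (n : ℕ) : ℝ := (1 / 2 : ℝ) ^ n

/-- The billiard table `Ω`, the union of the rectangles `[n, n + 1] × [0, p n]`. -/
def table : Set (ℝ × ℝ) :=
  ⋃ n : ℕ, Icc (n : ℝ) (n + 1) ×ˢ Icc 0 (p n)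

/-- The invariant surface is cut into columns `[i, i + 1]`, `i ∈ ℤ`: each rectangle of the
table appears, doubled to `[-p n, p n]` in the vertical direction, over `[n, n + 1]` and over
`[-n - 1, -n]`. `h i` is the half-height of the column `i`. -/
def h (i : ℤ) : ℝ := if 0 ≤ i then p i.toNat else p (-i - 1).toNat

/-- The vertical fibre `[-h i, h i[` of the column `i`; its ends are glued together. -/
def fibre (i : ℤ) : Set ℝ := Ico (-h i) (h i)

theorem h_pos (i : ℤ) : 0 < h i := by
  unfold h p
  split_ifs <;> positivity

theorem h_reflect (i : ℤ) : h (-i - 1) = h i := by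
  unfold h
  by_cases hi : 0 ≤ i
  · rw [if_neg (by omega), if_pos hi]
    congr 2
    omega
  · rw [if_pos (by omega), if_neg hi]

theorem two_h_pos (i : ℤ) : 0 < 2 * h i := by
  have := h_pos i
  linarith

/-- The representative in `[-h i, h i[` of `y` modulo `2 * h i`: the top side and the bottom
side of the column `i` are glued together. -/
def wrap (i : ℤ) (y : ℝ) : ℝ := toIcoMod (two_h_pos i) (-h i) y

theorem wrap_mem (i : ℤ) (y : ℝ) : wrap i y ∈ fibre i := by
  have := toIcoMod_mem_Ico (two_h_pos i) (-h i) y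
  have e : -h i + 2 * h i = h i := by ring
  rw [e] at this
  exact this

theorem wrap_eq_self {i : ℤ} {y : ℝ} (hy : y ∈ fibre i) : wrap i y = y := by
  have e : -h i + 2 * h i = h i := by ring
  refine (toIcoMod_eq_self (two_h_pos i)).2 ?_
  rw [e]
  exact hy

theorem wrap_wrap_add (i : ℤ) (y a : ℝ) : wrap i (wrap i y + a) = wrap i (y + a) := by
  have e : wrap i y + a = y + a - toIcoDiv (two_h_pos i) (-h i) y • (2 * h i) := by
    unfold wrap toIcoMod
    ring
  rw [e]
  exact toIcoMod_sub_zsmul (two_h_pos i) (-h i) (y + a) _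

/-- The invariant surface `R_α` (as a set it does not depend on `α`). Every point of the surface
is represented exactly once in the plane: the top side of a column is represented on the bottom
side, and the wall at the right end `X = n` of the column `n - 1`, i.e. the points `(n, Y)` with
`Y ∈ [-p (n-1), -p n[ ∪ [p n, p (n-1)[`, which is glued to the wall at the left end `X = -n` of
the column `-n` by `(n, Y) ∼ (-n, Y)`, is represented on the latter. -/
def Surface : Type := {z : ℝ × ℝ // z.2 ∈ fibre ⌊z.1⌋}

/-- The points of the surface on the vertical lines of integer abscissa. -/
def Section : Type := {s : ℤ × ℝ // s.2 ∈ fibre s.1}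

open Classical in
/-- The column entered from the vertical line `X = i`, reached from the left at the height `y`:
either the point goes through the aperture into the column `i`, or it hits the wall and
continues from the abscissa `-i`. (A wall is met only if `i > 0`.) Apertures are closed from
below and open from above: an orbit through `(n, p n)` behaves like the orbits above it, and an
orbit through `(n, -p n)` goes on to the column `n`. -/
def nextCol (i : ℤ) (y : ℝ) : ℤ := if y ∈ fibre i then i else -i

open Classical in
/-- The column from which the point `y` on the left side of the column `i` has been reached. -/
def prevCol (i : ℤ) (y : ℝ) : ℤ := if y ∈ fibre (i - 1) then i - 1 else -i - 1

theorem fibre_reflect {i j : ℤ} (hij : i + j = -1) : fibre i = fibre j := by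
  obtain rfl : i = -j - 1 := by omega
  unfold fibre
  rw [h_reflect]

theorem mem_fibre_nextCol {i : ℤ} {y : ℝ} (hy : y ∈ fibre i) : y ∈ fibre (nextCol (i + 1) y) := by
  unfold nextCol
  split_ifs with hc
  · exact hc
  · rwa [fibre_reflect (show -(i + 1) + i = -1 by ring)]

theorem mem_fibre_prevCol {i : ℤ} {y : ℝ} (hy : y ∈ fibre i) : y ∈ fibre (prevCol i y) := by
  unfold prevCol
  split_ifs with hc
  · exact hc
  · rwa [fibre_reflect (show -i - 1 + i = -1 by ring)]

theorem prevCol_nextCol {i : ℤ} {y : ℝ} (hy : y ∈ fibre i) :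
    prevCol (nextCol (i + 1) y) y = i := by
  by_cases hc : y ∈ fibre (i + 1)
  · have e : nextCol (i + 1) y = i + 1 := if_pos hc
    rw [e, prevCol, add_sub_cancel_right, if_pos hy]
  · have e : nextCol (i + 1) y = -(i + 1) := if_neg hc
    rw [e, prevCol, fibre_reflect (show -(i + 1) - 1 + (i + 1) = -1 by ring), if_neg hc]
    ring

theorem nextCol_prevCol {i : ℤ} {y : ℝ} (hy : y ∈ fibre i) :
    nextCol (prevCol i y + 1) y = i := by
  by_cases hc : y ∈ fibre (i - 1)
  · have e : prevCol i y = i - 1 := if_pos hc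
    rw [e, nextCol, sub_add_cancel, if_pos hy]
  · have e : prevCol i y = -i - 1 := if_neg hc
    rw [e, nextCol, fibre_reflect (show -i - 1 + 1 + (i - 1) = -1 by ring), if_neg hc]
    ring

/-- The motion in the direction of slope `α` from a vertical line `X = i` to the next one:
`Y` becomes `Y + α` modulo `2 * h i`, and the point enters the next column. -/
def nextLine (α : ℝ) (s : Section) : Section :=
  ⟨(nextCol (s.1.1 + 1) (wrap s.1.1 (s.1.2 + α)), wrap s.1.1 (s.1.2 + α)),
    mem_fibre_nextCol (wrap_mem _ _)⟩

/-- The inverse motion, to the previous vertical line of integer abscissa. -/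
def prevLine (α : ℝ) (s : Section) : Section :=
  ⟨(prevCol s.1.1 s.1.2, wrap (prevCol s.1.1 s.1.2) (s.1.2 - α)), wrap_mem _ _⟩

theorem prevLine_nextLine (α : ℝ) (s : Section) : prevLine α (nextLine α s) = s := by
  obtain ⟨⟨i, y⟩, hs⟩ := s
  apply Subtype.ext
  change (prevCol (nextCol (i + 1) (wrap i (y + α))) (wrap i (y + α)),
    wrap (prevCol (nextCol (i + 1) (wrap i (y + α))) (wrap i (y + α))) (wrap i (y + α) - α))
      = (i, y)
  rw [prevCol_nextCol (wrap_mem _ _), sub_eq_add_neg, wrap_wrap_add, add_neg_cancel_right,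
    wrap_eq_self hs]

theorem nextLine_prevLine (α : ℝ) (s : Section) : nextLine α (prevLine α s) = s := by
  obtain ⟨⟨i, y⟩, hs⟩ := s
  apply Subtype.ext
  have hb : wrap (prevCol i y) (wrap (prevCol i y) (y - α) + α) = y := by
    rw [wrap_wrap_add, sub_add_cancel]
    exact wrap_eq_self (mem_fibre_prevCol hs)
  change (nextCol (prevCol i y + 1) (wrap (prevCol i y) (wrap (prevCol i y) (y - α) + α)),
    wrap (prevCol i y) (wrap (prevCol i y) (y - α) + α)) = (i, y)
  rw [hb, nextCol_prevCol hs]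

/-- The motion between consecutive vertical lines of integer abscissa, as a bijection. -/
def lineMap (α : ℝ) : Equiv.Perm Section where
  toFun := nextLine α
  invFun := prevLine α
  left_inv := prevLine_nextLine α
  right_inv := nextLine_prevLine α

/-- The horizontal component of the unit vector `(1, α) / √(1 + α ^ 2)`. -/
def speedX (α : ℝ) : ℝ := 1 / √(1 + α ^ 2)

/-- The point where the orbit of `z` in the direction `α` entered the column of `z`. -/
def entry (α : ℝ) (z : Surface) : Section :=
  ⟨(⌊z.1.1⌋, wrap ⌊z.1.1⌋ (z.1.2 - α * Int.fract z.1.1)), wrap_mem _ _⟩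

/-- The point reached from `s` after a horizontal displacement `u ∈ [0, 1[` in its column. -/
def advance (α : ℝ) (s : Section) (u : Ico (0 : ℝ) 1) : Surface :=
  ⟨(s.1.1 + u, wrap s.1.1 (s.1.2 + α * u)), by
    have e : ⌊(s.1.1 : ℝ) + u⌋ = s.1.1 := by
      rw [Int.floor_intCast_add, Int.floor_eq_zero_iff.2 u.2, add_zero]
    simp only [e]
    exact wrap_mem _ _⟩

/-- The billiard flow `φ_α^t` on the invariant surface: motion with unit speed in the direction
`(1, α)` of the planar representation, for all times `t ∈ ℝ`. -/
def flow (α t : ℝ) (z : Surface) : Surface :=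
  let u := Int.fract z.1.1 + t * speedX α
  advance α ((lineMap α ^ ⌊u⌋) (entry α z)) ⟨Int.fract u, Int.fract_nonneg u, Int.fract_lt_one u⟩

/-- The projection of the invariant surface to the table: the unfolding is undone by reflecting
in the two coordinate axes. -/
def toTable (z : Surface) : ℝ × ℝ := (|z.1.1|, |z.1.2|)

theorem toTable_mem (z : Surface) : toTable z ∈ table := by
  obtain ⟨⟨x, y⟩, hy⟩ := z
  change -h ⌊x⌋ ≤ y ∧ y < h ⌊x⌋ at hy
  have h1 := Int.floor_le x
  have h2 := Int.lt_floor_add_one x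
  have hy' : |y| ≤ h ⌊x⌋ := abs_le.2 ⟨hy.1, hy.2.le⟩
  by_cases hx : 0 ≤ ⌊x⌋
  · have hx0 : 0 ≤ x := Int.floor_nonneg.1 hx
    have hc : ((⌊x⌋.toNat : ℕ) : ℝ) = (⌊x⌋ : ℝ) := by exact_mod_cast Int.toNat_of_nonneg hx
    refine mem_iUnion.2 ⟨⌊x⌋.toNat, ⟨?_, ?_⟩, abs_nonneg _, ?_⟩
    · simp only [toTable, hc, abs_of_nonneg hx0, h1]
    · simp only [toTable, hc, abs_of_nonneg hx0, h2.le]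
    · simpa [toTable, h, hx] using hy'
  · have hx0 : x < 0 := by
      by_contra hcon
      exact hx (Int.floor_nonneg.2 (not_lt.1 hcon))
    have hc : (((-⌊x⌋ - 1).toNat : ℕ) : ℝ) = -(⌊x⌋ : ℝ) - 1 := by
      exact_mod_cast Int.toNat_of_nonneg (show 0 ≤ -⌊x⌋ - 1 by omega)
    refine mem_iUnion.2 ⟨(-⌊x⌋ - 1).toNat, ⟨?_, ?_⟩, abs_nonneg _, ?_⟩
    · simp only [toTable, hc, abs_of_neg hx0]
      linarith
    · simp only [toTable, hc, abs_of_neg hx0]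
      linarith
    · simpa [toTable, h, hx] using hy'

/-- The position in the table at time `t` of the particle that is at `z` at time `0`. -/
def position (α : ℝ) (z : Surface) (t : ℝ) : ℝ × ℝ := toTable (flow α t z)

/-- The forward semi-orbit of `z` escapes: from some time on, the particle in the table goes to
the right with constant horizontal velocity (so that it never hits a vertical wall again, and
goes to infinity). -/
def EscapesForward (α : ℝ) (z : Surface) : Prop :=
  ∃ T : ℝ, ∀ t ≥ T, (position α z t).1 = (position α z T).1 + (t - T) * speedX α

/-- The backward semi-orbit of `z` escapes: up to some time, the particle in the table comes
from infinity with constant negative horizontal velocity. -/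
def EscapesBackward (α : ℝ) (z : Surface) : Prop :=
  ∃ T : ℝ, ∀ t ≤ T, (position α z t).1 = (position α z T).1 - (t - T) * speedX α

/-- The backward semi-orbit of `z` is unbounded. -/
def UnboundedBackward (α : ℝ) (z : Surface) : Prop :=
  ¬ Bornology.IsBounded (position α z '' Iic 0)

/-- The backward semi-orbit of `z` is oscillating: it is unbounded and does not escape. -/
def OscillatesBackward (α : ℝ) (z : Surface) : Prop :=
  UnboundedBackward α z ∧ ¬ EscapesBackward α z

/-- The orbit of `z` on the invariant surface. -/
def orbit (α : ℝ) (z : Surface) : Set Surface := range fun t => flow α t z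

/-- An escape orbit in the direction `α`. -/
def IsEscapeOrbit (α : ℝ) (η : Set Surface) : Prop :=
  ∃ z : Surface, η = orbit α z ∧ EscapesForward α z

/-- An orbit that is oscillating in the past. -/
def IsOscillatingInThePast (α : ℝ) (η : Set Surface) : Prop :=
  ∀ z ∈ η, OscillatesBackward α z

end StepBilliard

end

/-!
An orbit escapes exactly if, after its last passage through the line `X = 0`, its heights `y j` on
the lines `X = j` satisfy `|y j| ≤ p j` and `y (j + 1) = y j + α` modulo `2 * p j`
(`IsEscapeSeq`). So the escape orbits correspond to the escape sequences.

Two orbits that arrive at the aperture `n + 1` may have been separated before, but only by a vertex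
`(k, p k)` whose forward orbit also arrives at that aperture. The conditions that the latter passes
all the apertures in between force `2 ^ (k + 1) * α` to be so close to an integer that
`2 ^ (n - 1) * α` cannot lie in `(1 / 8, 1 / 4)` modulo one (`not_passes_of_vertex`). For almost
every `α` this does occur for infinitely many `n`, which are called good levels here. Behind a good
level all arriving orbits have been parallel since `X = 0` (`Passes.sub_eq_sub`), so they form a
single beam of width `2 * p (n + 1)`. The beams of the good levels are nested and shrink to a point:
there is exactly one escape sequence `y`.

If this orbit escaped in the past as well, then, the escape sequences of the slope `-α` being the
opposites of those of `α`, the orbit would contain the heights `y 0` and `-y 0` on the line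
`X = 0`, so that `2 * y 0 = m * α + d` with `m` an integer and `d` a dyadic rational. The apertures
would then keep `(2 * j + m) * 2 ^ j / 8 * α` within `1 / 4` of the integers for all large `j`
(`IsEscapeSeq.two_mul_ne`), which happens for almost no `α`. Both almost-sure statements come from
`ae_frequently_fract_mem_Ioo`, a consequence of the Lebesgue density theorem.

Finally, the backward orbit is unbounded for every `α`: a backward orbit that starts from the column
`M` has to pass through the opposite aperture, into the column `-M - 1`, since otherwise a short
interval would have infinitely many disjoint translates in a region of finite measure
(`exists_prevLine_iterate_col_eq`).
-/

namespace StepBilliard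

/-! ### Lacunary sequences modulo one -/

/-- The exceptional set is a countable union of sets whose relative density in the balls of radius
`(q n)⁻¹` stays below `1 - (b - a) / 2`, hence of sets without density points. -/
theorem ae_frequently_fract_mem_Ioo {q : ℕ → ℝ} (hq : Filter.Tendsto q Filter.atTop Filter.atTop)
    {a b : ℝ} (ha : 0 ≤ a) (hab : a < b) (hb : b ≤ 1) :
    ∀ᵐ x : ℝ, ∃ᶠ n in Filter.atTop, Int.fract (q n * x) ∈ Ioo a b := by
  have key : ∀ N : ℕ, volume {x : ℝ | ∀ n ≥ N, Int.fract (q n * x) ∉ Ioo a b} = 0 := by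
    intro N
    set s : Set ℝ := {x : ℝ | ∀ n ≥ N, Int.fract (q n * x) ∉ Ioo a b} with hs
    have hd := Besicovitch.ae_tendsto_measure_inter_div (volume : Measure ℝ) s
    suffices h : ∀ᵐ _x ∂(volume.restrict s), False by
      simpa using h
    filter_upwards [hd] with x hx
    have hr : Filter.Tendsto (fun n => (q n)⁻¹) Filter.atTop (nhdsWithin 0 (Ioi 0)) :=
      tendsto_inv_atTop_nhdsGT_zero.comp hq
    have hlim := hx.comp hr
    have hle : ∀ᶠ n in Filter.atTop,
        ((fun r => volume (s ∩ Metric.closedBall x r) / volume (Metric.closedBall x r)) ∘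
          fun n => (q n)⁻¹) n ≤ ENNReal.ofReal (1 - (b - a) / 2) := by
      filter_upwards [hq.eventually_gt_atTop 0, Filter.eventually_ge_atTop N] with n hn hN
      simp only [Function.comp]
      have hr0 : 0 < (q n)⁻¹ := inv_pos.2 hn
      set k : ℤ := ⌊q n * x⌋
      -- On this interval, contained in the ball, the fractional part of `q n * x` is in `(a, b)`.
      set J : Set ℝ := Ioo ((k + a) / q n) ((k + b) / q n)
      have hk1 : (k : ℝ) ≤ q n * x := Int.floor_le _
      have hk2 : q n * x < k + 1 := Int.lt_floor_add_one _
      have hJs : s ∩ Metric.closedBall x (q n)⁻¹ ⊆ Metric.closedBall x (q n)⁻¹ \ J := by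
        rintro z ⟨hz, hzb⟩
        refine ⟨hzb, fun hzJ => hz n hN ?_⟩
        have h1 := (div_lt_iff₀ hn).1 hzJ.1
        have h2 := (lt_div_iff₀ hn).1 hzJ.2
        have hf : ⌊q n * z⌋ = k := by
          rw [Int.floor_eq_iff]
          constructor <;> nlinarith
        rw [Int.fract, hf]
        constructor <;> nlinarith
      have hJb : J ⊆ Metric.closedBall x (q n)⁻¹ := by
        rw [Real.closedBall_eq_Icc]
        refine Ioo_subset_Icc_self.trans (Icc_subset_Icc ?_ ?_)
        · rw [le_div_iff₀ hn, sub_mul, inv_mul_cancel₀ hn.ne']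
          linarith
        · rw [div_le_iff₀ hn, add_mul, inv_mul_cancel₀ hn.ne']
          linarith
      have hvJ : volume J = ENNReal.ofReal ((b - a) * (q n)⁻¹) := by
        rw [Real.volume_Ioo]
        congr 1
        ring
      have hv : volume (s ∩ Metric.closedBall x (q n)⁻¹) ≤
          ENNReal.ofReal (2 * (q n)⁻¹ - (b - a) * (q n)⁻¹) := by
        refine (measure_mono hJs).trans ?_
        rw [measure_sdiff hJb measurableSet_Ioo.nullMeasurableSet (by rw [hvJ]; simp), hvJ,
          Real.volume_closedBall, ENNReal.ofReal_sub]
        exact mul_nonneg (by linarith) hr0.le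
      rw [Real.volume_closedBall]
      refine (ENNReal.div_le_div_right hv _).trans ?_
      rw [← ENNReal.ofReal_div_of_pos (by positivity)]
      apply ENNReal.ofReal_le_ofReal
      apply le_of_eq
      field_simp
    have h1 := le_of_tendsto hlim hle
    rw [ENNReal.one_le_ofReal] at h1
    linarith
  have : ∀ᵐ x : ℝ, ∀ N : ℕ, ¬ ∀ n ≥ N, Int.fract (q n * x) ∉ Ioo a b := by
    rw [ae_all_iff]
    intro N
    rw [ae_iff]
    simpa using key N
  filter_upwards [this] with x hx
  rw [Filter.frequently_atTop]
  intro N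
  have := hx N
  push Not at this
  exact this

/-! ### Orbits through a vertex -/

theorem p_pos (n : ℕ) : 0 < p n := by
  unfold p
  positivity

theorem p_eq_two_mul_succ (n : ℕ) : p n = 2 * p (n + 1) := by
  unfold p
  ring

theorem p_antitone : Antitone p := fun _ _ hmn =>
  pow_le_pow_of_le_one (by norm_num) (by norm_num) hmn

theorem p_mul_two_pow (n : ℕ) : p n * 2 ^ n = 1 := by
  unfold p
  rw [← mul_pow]
  norm_num

theorem tendsto_p : Filter.Tendsto p Filter.atTop (nhds 0) :=
  tendsto_pow_atTop_nhds_zero_of_lt_one (by norm_num) (by norm_num)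

theorem ne_quarter_of_irrational {x : ℝ} (hx : Irrational x) : |x| ≠ 1 / 4 := by
  intro h
  rcases (abs_eq (by norm_num)).1 h with h | h
  · exact hx ⟨1 / 4, by push_cast; exact h.symm⟩
  · exact hx ⟨-(1 / 4), by push_cast; exact h.symm⟩

/-- The arithmetic behind `not_passes_of_vertex`: the orbit of a vertex remains in the apertures of
`m + 1` consecutive levels only if `4 * X` is within `1 / ((m + 1) * 2 ^ m)` of an integer, and
this keeps `2 ^ m * X` away from the interval `(1 / 8, 1 / 4)` modulo one. -/
theorem fract_two_pow_mul_notMem_of_vertex {X : ℝ} (hX : Irrational X) {m : ℕ}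
    (H : ∀ i ≤ m, ∃ z : ℤ, |(2 : ℝ) ^ i / 2 + (i + 1) * 2 ^ i * X + z| ≤ 1 / 4) :
    Int.fract (2 ^ m * X) ∉ Ioo (1 / 8 : ℝ) (1 / 4) := by
  intro hf
  rw [Int.fract] at hf
  set M : ℤ := ⌊2 ^ m * X⌋
  obtain ⟨hf1, hf2⟩ := hf
  -- For `1 ≤ i` the first summand is an integer.
  have H' : ∀ i : ℕ, i + 1 ≤ m →
      ∃ z : ℤ, |((i : ℝ) + 2) * 2 ^ (i + 1) * X + z| < 1 / 4 := by
    intro i hi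
    obtain ⟨z, hz⟩ := H (i + 1) hi
    refine ⟨z + 2 ^ i, ?_⟩
    have e : (2 : ℝ) ^ (i + 1) / 2 + ((i + 1 : ℕ) + 1) * 2 ^ (i + 1) * X + z
        = ((i : ℝ) + 2) * 2 ^ (i + 1) * X + ((z + 2 ^ i : ℤ) : ℝ) := by
      push_cast
      ring
    rw [e] at hz
    refine lt_of_le_of_ne hz (ne_quarter_of_irrational ?_)
    have h2 : Irrational (((i + 2) * 2 ^ (i + 1) : ℕ) * X) :=
      hX.natCast_mul (by positivity)
    have h3 := h2.add_intCast (z + 2 ^ i)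
    push_cast at h3 ⊢
    exact h3
  -- Only for `2 ≤ m` is `2 ^ m * X` an integer multiple of `4 * X`; the levels `0` and `1` are
  -- treated separately.
  rcases m with _ | m
  · obtain ⟨z, hz⟩ := H 0 le_rfl
    rw [abs_le] at hz
    norm_num at hz hf1 hf2
    have h1 : (-1 : ℝ) < ((M + z : ℤ) : ℝ) := by push_cast; linarith
    have h2 : ((M + z : ℤ) : ℝ) < 0 := by push_cast; linarith
    have h1' : -1 < M + z := by exact_mod_cast h1
    have h2' : M + z < 0 := by exact_mod_cast h2
    omega
  · obtain ⟨z₀, hz₀⟩ := H' 0 (by omega)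
    set Z : ℤ := -z₀
    have hC : ∀ i : ℕ, i ≤ m → |4 * X - Z| * ((i + 2) * 2 ^ (i + 1)) < 1 := by
      intro i
      induction i with
      | zero =>
        intro _
        have e : ((0 : ℕ) + 2 : ℝ) * 2 ^ (0 + 1) * X + z₀ = 4 * X - Z := by
          simp only [Z]
          push_cast
          ring
        rw [e] at hz₀
        norm_num
        linarith
      | succ i ih =>
        intro hi
        have ih := ih (by omega)
        obtain ⟨z, hz⟩ := H' (i + 1) (by omega)
        set w : ℤ := z + (i + 3) * 2 ^ i * Z with hw
        set B : ℝ := (i + 3) * 2 ^ i * (4 * X - Z)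
        have e : ((i + 1 : ℕ) + 2 : ℝ) * 2 ^ (i + 1 + 1) * X + z = B + w := by
          simp only [B, hw]
          push_cast
          ring
        rw [e] at hz
        have hBabs : |B| = |4 * X - Z| * ((i + 3) * 2 ^ i) := by
          simp only [B]
          rw [abs_mul, abs_of_nonneg (by positivity), mul_comm]
        -- The ratio `(i + 3) / (2 (i + 2))` of consecutive bounds is at most `3 / 4`.
        have hB : |B| < 3 / 4 := by
          have h4 : |B| * (2 * (i + 2)) < i + 3 := by
            rw [hBabs]
            have : (0 : ℝ) < i + 3 := by positivity
            calc |4 * X - Z| * ((i + 3) * 2 ^ i) * (2 * (i + 2))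
                = (|4 * X - Z| * ((i + 2) * 2 ^ (i + 1))) * (i + 3) := by ring
              _ < 1 * (i + 3) := by gcongr
              _ = i + 3 := one_mul _
          have hi0 : (0 : ℝ) ≤ i := Nat.cast_nonneg i
          by_contra hcon
          nlinarith
        have hw0 : w = 0 := by
          have h5 : |(w : ℝ)| < 1 := by
            have : (w : ℝ) = (B + w) - B := by ring
            rw [this]
            refine (abs_sub _ _).trans_lt ?_
            linarith
          exact Int.abs_lt_one_iff.1 (by exact_mod_cast h5)
        rw [hw0, Int.cast_zero, add_zero, hBabs] at hz
        have : |4 * X - Z| * (((i + 1 : ℕ) + 2) * 2 ^ (i + 1 + 1))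
            = 4 * (|4 * X - Z| * ((i + 3) * 2 ^ i)) := by
          push_cast
          ring
        rw [this]
        linarith
    rcases m with _ | m
    · have h0 := hC 0 le_rfl
      have h1 : |4 * X - Z| < 1 / 4 := by
        norm_num at h0
        linarith
      rw [abs_lt] at h1
      norm_num at hf1 hf2
      have h2 : (0 : ℝ) < ((Z - 2 * M : ℤ) : ℝ) := by push_cast; linarith
      have h3 : ((Z - 2 * M : ℤ) : ℝ) < 1 := by push_cast; linarith
      have h2' : 0 < Z - 2 * M := by exact_mod_cast h2
      have h3' : Z - 2 * M < 1 := by exact_mod_cast h3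
      omega
    · have h0 := hC (m + 1) le_rfl
      have h1 : |2 ^ m * (4 * X - Z)| < 1 / 12 := by
        rw [abs_mul, abs_of_pos (by positivity : (0 : ℝ) < 2 ^ m)]
        push_cast at h0
        have hm0 : (0 : ℝ) ≤ m := Nat.cast_nonneg m
        have h6 : 2 ^ m * |4 * X - Z| * (4 * (m + 3)) < 1 := by
          calc 2 ^ m * |4 * X - Z| * (4 * (m + 3))
              = |4 * X - Z| * ((m + 1 + 2) * 2 ^ (m + 1 + 1)) := by ring
            _ < 1 := h0
        have h7 : 0 ≤ 2 ^ m * |4 * X - Z| := by positivity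
        nlinarith
      rw [abs_lt] at h1
      have e : (2 : ℝ) ^ (m + 1 + 1) * X = 2 ^ m * (4 * X - Z) + 2 ^ m * Z := by ring
      rw [e] at hf1 hf2
      have h2 : (0 : ℝ) < ((2 ^ m * Z - M : ℤ) : ℝ) := by push_cast; linarith
      have h3 : ((2 ^ m * Z - M : ℤ) : ℝ) < 1 := by push_cast; linarith
      have h2' : 0 < 2 ^ m * Z - M := by exact_mod_cast h2
      have h3' : 2 ^ m * Z - M < 1 := by exact_mod_cast h3
      omega

/-- The heights `v k, …, v N` at which an orbit of slope `α` crosses the lines `X = k, …, X = N`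
while it goes to the right without meeting a wall. The apertures are taken closed. -/
def Passes (α : ℝ) (k N : ℕ) (v : ℕ → ℝ) : Prop :=
  (∀ j, k ≤ j → j ≤ N → |v j| ≤ p j) ∧
    ∀ j, k ≤ j → j < N → ∃ z : ℤ, v (j + 1) = v j + α + 2 * p j * z

theorem Passes.mono {α : ℝ} {k k' N N' : ℕ} {v : ℕ → ℝ} (h : Passes α k N v) (hk : k ≤ k')
    (hN : N' ≤ N) : Passes α k' N' v :=
  ⟨fun j h1 h2 => h.1 j (hk.trans h1) (h2.trans hN),
    fun j h1 h2 => h.2 j (hk.trans h1) (h2.trans_le hN)⟩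

/-- The condition on the level `n` which ensures that the orbits arriving at the aperture `n + 1`
have been parallel since they left the line `X = 0`. -/
def IsGoodLevel (α : ℝ) (n : ℕ) : Prop := Int.fract (2 ^ n * (α / 2)) ∈ Ioo (1 / 8 : ℝ) (1 / 4)

/-- The orbit of the vertex of height `p k` (equivalently `-p k`, as the sides of the column `k` are
glued) does not pass all the apertures up to the one behind a good level. -/
theorem not_passes_of_vertex {α : ℝ} (hα : Irrational α) {k n : ℕ} (hkn : k ≤ n)
    (hn : IsGoodLevel α n) {v : ℕ → ℝ} (hv : ∃ z : ℤ, v (k + 1) = p k + α + 2 * p k * z) :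
    ¬ Passes α (k + 1) (n + 1) v := by
  rintro ⟨hb, hrec⟩
  have hform : ∀ i : ℕ, k + i ≤ n →
      ∃ z : ℤ, v (k + i + 1) = p k + (i + 1) * α + 2 * p (k + i) * z := by
    intro i
    induction i with
    | zero => intro _; simpa using hv
    | succ i ih =>
      intro hi
      obtain ⟨z, hz⟩ := ih (by omega)
      obtain ⟨z', hz'⟩ := hrec (k + i + 1) (by omega) (by omega)
      refine ⟨2 * z + z', ?_⟩
      rw [← add_assoc, hz', hz, p_eq_two_mul_succ (k + i)]
      push_cast
      ring
  have hX : Irrational (2 ^ k * (α / 2)) := by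
    have h1 : Irrational (α / (2 : ℕ)) := hα.div_natCast (by norm_num)
    have h2 := h1.natCast_mul (m := 2 ^ k) (by positivity)
    push_cast at h2
    exact h2
  obtain ⟨m, rfl⟩ := Nat.exists_eq_add_of_le hkn
  refine fract_two_pow_mul_notMem_of_vertex hX (m := m) (fun i hi => ?_) ?_
  · obtain ⟨z, hz⟩ := hform i (by omega)
    have hb' := hb (k + i + 1) (by omega) (by omega)
    rw [hz] at hb'
    refine ⟨z, ?_⟩
    have hq := p_mul_two_pow k
    have hq' := p_mul_two_pow (k + i)
    have hs := p_eq_two_mul_succ (k + i)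
    have e : (2 : ℝ) ^ i / 2 + (i + 1) * 2 ^ i * (2 ^ k * (α / 2)) + z
        = (2 ^ (k + i) / 2) * (p k + (i + 1) * α + 2 * p (k + i) * z) := by
      have e1 : (2 : ℝ) ^ (k + i) / 2 * p k = 2 ^ i / 2 := by
        calc (2 : ℝ) ^ (k + i) / 2 * p k = (p k * 2 ^ k) * 2 ^ i / 2 := by ring
          _ = _ := by rw [hq, one_mul]
      have e2 : (2 : ℝ) ^ (k + i) / 2 * (2 * p (k + i) * z) = z := by
        calc (2 : ℝ) ^ (k + i) / 2 * (2 * p (k + i) * z) = (p (k + i) * 2 ^ (k + i)) * z := by ring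
          _ = _ := by rw [hq', one_mul]
      rw [mul_add, mul_add, e1, e2]
      ring
    rw [e, abs_mul, abs_of_pos (by positivity : (0 : ℝ) < 2 ^ (k + i) / 2)]
    calc (2 : ℝ) ^ (k + i) / 2 * _ ≤ 2 ^ (k + i) / 2 * p (k + i + 1) := by gcongr
      _ = (p (k + i) * 2 ^ (k + i)) / 4 := by rw [hs]; ring
      _ = 1 / 4 := by rw [hq']
  · have e : (2 : ℝ) ^ m * (2 ^ k * (α / 2)) = 2 ^ (k + m) * (α / 2) := by ring
    rw [e]
    exact hn

theorem Passes.sub_le_of_parallel {α : ℝ} (hα : Irrational α) {k n : ℕ} (hkn : k ≤ n)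
    (hn : IsGoodLevel α n) {y y' : ℕ → ℝ} (hy : Passes α k (n + 1) y)
    (hy' : Passes α k (n + 1) y')
    (hpar : ∀ j, k + 1 ≤ j → j ≤ n + 1 → y j - y' j = y (k + 1) - y' (k + 1)) :
    y k - y' k ≤ y (k + 1) - y' (k + 1) := by
  by_contra! hcon
  obtain ⟨l, hl⟩ := hy.2 k le_rfl (by omega)
  obtain ⟨l', hl'⟩ := hy'.2 k le_rfl (by omega)
  have hp := p_pos k
  have hll : l < l' := by
    have h1 : 2 * p k * l < 2 * p k * l' := by linarith
    have h2 : (l : ℝ) < l' := lt_of_mul_lt_mul_left h1 (by positivity)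
    exact_mod_cast h2
  have hll' : (l : ℝ) + 1 ≤ l' := by exact_mod_cast hll
  have hyk := abs_le.1 (hy.1 k le_rfl (by omega))
  have hyk' := abs_le.1 (hy'.1 k le_rfl (by omega))
  -- The segment between the two orbits contains the vertex of height `p k`, shifted by `t`
  -- from the orbit `y`.
  set t : ℝ := p k - y k with ht
  have ht0 : 0 ≤ t := by linarith
  have ht1 : y (k + 1) + t ≤ y' (k + 1) := by
    have : 2 * p k * (l + 1) ≤ 2 * p k * l' := by gcongr
    rw [hl, hl', ht]
    linarith
  refine not_passes_of_vertex hα hkn hn (v := fun j => y j + t) ⟨l, ?_⟩ ⟨fun j h1 h2 => ?_,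
    fun j h1 h2 => ?_⟩
  · simp only [hl, ht]
    ring
  · have h3 := hpar j h1 h2
    have h4 := abs_le.1 (hy.1 j (by omega) h2)
    have h5 := abs_le.1 (hy'.1 j (by omega) h2)
    rw [abs_le]
    constructor <;> linarith
  · obtain ⟨z, hz⟩ := hy.2 j (by omega) h2
    exact ⟨z, by simp only [hz]; ring⟩

/-- Two orbits arriving at the aperture behind a good level have been parallel all along: where they
separate, going backwards, the orbit of a vertex lies between them. -/
theorem Passes.sub_eq_sub {α : ℝ} (hα : Irrational α) {n : ℕ} (hn : IsGoodLevel α n)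
    {y y' : ℕ → ℝ} (hy : Passes α 0 (n + 1) y) (hy' : Passes α 0 (n + 1) y') {j : ℕ}
    (hj : j ≤ n + 1) : y j - y' j = y (n + 1) - y' (n + 1) := by
  suffices h : ∀ i ≤ n + 1, ∀ j, n + 1 - i ≤ j → j ≤ n + 1 →
      y j - y' j = y (n + 1) - y' (n + 1) from h (n + 1) le_rfl j (by omega) hj
  intro i
  induction i with
  | zero =>
    intro _ j h1 h2
    obtain rfl : j = n + 1 := by omega
    rfl
  | succ i ih =>
    intro hi j h1 h2
    have ih := ih (by omega)
    rcases Nat.lt_or_ge j (n + 1 - i) with h3 | h3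
    · have hjn : j ≤ n := by omega
      have e := ih (j + 1) (by omega) (by omega)
      rw [← e]
      refine le_antisymm ?_ ?_
      · refine Passes.sub_le_of_parallel hα hjn hn (hy.mono (by omega) le_rfl)
          (hy'.mono (by omega) le_rfl) fun m hm1 hm2 => ?_
        rw [e, ih m (by omega) hm2]
      · have h5 := Passes.sub_le_of_parallel hα hjn hn (hy'.mono (by omega) le_rfl)
          (hy.mono (by omega) le_rfl) fun m hm1 hm2 => by
            have := ih m (by omega) hm2
            linarith
        linarith
    · exact ih j h3 h2

/-! ### Existence and uniqueness of the escape sequence -/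

/-- The heights at which an orbit of slope `α` crosses the lines `X = 0, 1, 2, …` when it goes
to infinity without meeting a wall. The apertures are taken closed. -/
def IsEscapeSeq (α : ℝ) (y : ℕ → ℝ) : Prop :=
  (∀ j, |y j| ≤ p j) ∧ ∀ j, ∃ z : ℤ, y (j + 1) = y j + α + 2 * p j * z

theorem IsEscapeSeq.passes {α : ℝ} {y : ℕ → ℝ} (h : IsEscapeSeq α y) (k N : ℕ) :
    Passes α k N y :=
  ⟨fun j _ _ => h.1 j, fun j _ _ => h.2 j⟩

theorem IsEscapeSeq.neg {α : ℝ} {y : ℕ → ℝ} (h : IsEscapeSeq (-α) y) :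
    IsEscapeSeq α fun j => -y j := by
  refine ⟨fun j => by rw [abs_neg]; exact h.1 j, fun j => ?_⟩
  obtain ⟨z, hz⟩ := h.2 j
  refine ⟨-z, ?_⟩
  simp only [hz]
  push_cast
  ring

theorem exists_passes (α : ℝ) (N : ℕ) {w : ℝ} (hw : |w| ≤ p N) :
    ∃ y : ℕ → ℝ, y N = w ∧ Passes α 0 N y := by
  induction N generalizing w with
  | zero =>
    refine ⟨fun _ => w, rfl, fun j _ h2 => ?_, fun j _ h2 => absurd h2 (by omega)⟩
    obtain rfl : j = 0 := by omega
    exact hw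
  | succ N ih =>
    have hp := p_pos N
    set r : ℤ := round ((w - α) / (2 * p N))
    obtain ⟨y, hyN, hy⟩ := ih (w := w - α - 2 * p N * r) (by
      have h1 := abs_sub_round ((w - α) / (2 * p N))
      have e : w - α - 2 * p N * r = 2 * p N * ((w - α) / (2 * p N) - r) := by
        field_simp
      rw [e, abs_mul, abs_of_pos (by positivity)]
      calc 2 * p N * _ ≤ 2 * p N * (1 / 2) := by gcongr
        _ = p N := by ring)
    refine ⟨Function.update y (N + 1) w, Function.update_self .., fun j _ h2 => ?_,
      fun j _ h2 => ?_⟩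
    · rcases eq_or_ne j (N + 1) with rfl | h3
      · rwa [Function.update_self]
      · rw [Function.update_of_ne h3]
        exact hy.1 j (Nat.zero_le _) (by omega)
    · rw [Function.update_of_ne (show j ≠ N + 1 by omega)]
      rcases eq_or_ne j N with rfl | h3
      · rw [Function.update_self, hyN]
        exact ⟨r, by ring⟩
      · rw [Function.update_of_ne (by omega)]
        exact hy.2 j (Nat.zero_le _) (by omega)

/-- The closure of the apertures is harmless, as an escape sequence meets no vertex. -/
theorem IsEscapeSeq.abs_lt {α : ℝ} (hα : Irrational α)
    (hgood : ∃ᶠ n in Filter.atTop, IsGoodLevel α n) {y : ℕ → ℝ} (hy : IsEscapeSeq α y) (j : ℕ) :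
    |y j| < p j := by
  refine lt_of_le_of_ne (hy.1 j) fun h => ?_
  obtain ⟨n, hjn, hn⟩ := Filter.frequently_atTop.1 hgood j
  obtain ⟨z, hz⟩ := hy.2 j
  rcases (abs_eq (p_pos j).le).1 h with h | h
  · exact not_passes_of_vertex hα hjn hn ⟨z, by rw [hz, h]⟩ (hy.passes _ _)
  · refine not_passes_of_vertex hα hjn hn ⟨z - 1, ?_⟩ (hy.passes _ _)
    rw [hz, h]
    push_cast
    ring

theorem IsEscapeSeq.unique {α : ℝ} (hα : Irrational α)
    (hgood : ∃ᶠ n in Filter.atTop, IsGoodLevel α n) {y y' : ℕ → ℝ} (hy : IsEscapeSeq α y)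
    (hy' : IsEscapeSeq α y') : y = y' := by
  funext j
  have hlim : Filter.Tendsto (fun n => 2 * p n) Filter.atTop (nhds 0) := by
    simpa using tendsto_p.const_mul 2
  have h0 : |y j - y' j| ≤ 0 := by
    refine ge_of_tendsto_of_frequently hlim ((hgood.and_eventually
      (Filter.eventually_ge_atTop j)).mono fun n hn => ?_)
    rw [Passes.sub_eq_sub hα hn.1 (hy.passes 0 _) (hy'.passes 0 _) (j := j) (by omega)]
    have h3 := hy.1 (n + 1)
    have h4 := hy'.1 (n + 1)
    have h5 := p_antitone (Nat.le_add_right n 1)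
    exact (abs_sub _ _).trans (by linarith)
  exact sub_eq_zero.1 (abs_nonpos_iff.1 h0)

/-- The escape sequence is the limit of orbits that arrive at the apertures behind good levels; they
converge because each good level makes the later ones parallel up to it. -/
theorem exists_isEscapeSeq {α : ℝ} (hα : Irrational α)
    (hgood : ∃ᶠ n in Filter.atTop, IsGoodLevel α n) : ∃ y, IsEscapeSeq α y := by
  choose g hg hgg using Filter.frequently_atTop.1 hgood
  have hS : ∀ N, ∃ y, Passes α 0 (g N + 1) y := fun N =>
    let ⟨y, _, hy⟩ := exists_passes α (g N + 1) (w := 0) (by simpa using (p_pos _).le)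
    ⟨y, hy⟩
  choose S hSp using hS
  have hcomp : ∀ n : ℕ, IsGoodLevel α n → ∀ N N', n ≤ g N → n ≤ g N' → ∀ j ≤ n + 1,
      |S N j - S N' j| ≤ 2 * p n := by
    intro n hn N N' h1 h2 j hj
    have hp1 := (hSp N).mono le_rfl (show n + 1 ≤ g N + 1 by omega)
    have hp2 := (hSp N').mono le_rfl (show n + 1 ≤ g N' + 1 by omega)
    rw [Passes.sub_eq_sub hα hn hp1 hp2 hj]
    have h3 := hp1.1 (n + 1) (Nat.zero_le _) le_rfl
    have h4 := hp2.1 (n + 1) (Nat.zero_le _) le_rfl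
    have h5 := p_antitone (Nat.le_succ n)
    exact (abs_sub _ _).trans (by simp only [Nat.succ_eq_add_one] at h5; linarith)
  have hdist : ∀ B N N' j : ℕ, j ≤ B → B ≤ N → B ≤ N' → |S N j - S N' j| ≤ 2 * p B := by
    intro B N N' j hj h1 h2
    rcases le_total (g N) (g N') with h | h
    · refine (hcomp _ (hgg N) N N' le_rfl h j (by have := hg N; omega)).trans ?_
      have := p_antitone (h1.trans (hg N))
      linarith
    · refine (hcomp _ (hgg N') N N' h le_rfl j (by have := hg N'; omega)).trans ?_
      have := p_antitone (h2.trans (hg N'))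
      linarith
  have hlim : ∀ j, ∃ l, Filter.Tendsto (fun N => S N j) Filter.atTop (nhds l) := by
    intro j
    have hc : CauchySeq fun N => S (N + j) j := by
      refine cauchySeq_of_le_tendsto_0 (fun N => 2 * p N) (fun n m N hn hm => ?_) ?_
      · rw [Real.dist_eq]
        refine (hdist (N + j) (n + j) (m + j) j (by omega) (by omega) (by omega)).trans ?_
        have := p_antitone (Nat.le_add_right N j)
        linarith
      · simpa using tendsto_p.const_mul 2
    obtain ⟨l, hl⟩ := cauchySeq_tendsto_of_complete hc
    exact ⟨l, (Filter.tendsto_add_atTop_iff_nat j).1 hl⟩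
  choose y hy using hlim
  refine ⟨y, fun j => ?_, fun j => ?_⟩
  · refine le_of_tendsto (hy j).abs ?_
    filter_upwards [Filter.eventually_ge_atTop j] with N hN
    exact (hSp N).1 j (Nat.zero_le _) (by have := hg N; omega)
  · have hp := p_pos j
    have h1 : Filter.Tendsto (fun N => (S N (j + 1) - S N j - α) / (2 * p j)) Filter.atTop
        (nhds ((y (j + 1) - y j - α) / (2 * p j))) :=
      (((hy (j + 1)).sub (hy j)).sub_const α).div_const _
    have h2 : (y (j + 1) - y j - α) / (2 * p j) ∈ range ((↑) : ℤ → ℝ) := by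
      refine Int.isClosedEmbedding_coe_real.isClosed_range.mem_of_tendsto h1 ?_
      filter_upwards [Filter.eventually_ge_atTop j] with N hN
      obtain ⟨z, hz⟩ := (hSp N).2 j (Nat.zero_le _) (by have := hg N; omega)
      refine ⟨z, ?_⟩
      rw [hz]
      field_simp
      ring
    obtain ⟨z, hz⟩ := h2
    refine ⟨z, ?_⟩
    rw [hz]
    field_simp
    ring

theorem IsEscapeSeq.exists_eq {α : ℝ} {y : ℕ → ℝ} (hy : IsEscapeSeq α y) (j : ℕ) :
    ∃ z : ℤ, y (j + 1) = y 0 + (j + 1) * α + 2 * p j * z := by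
  induction j with
  | zero => simpa using hy.2 0
  | succ j ih =>
    obtain ⟨z, hz⟩ := ih
    obtain ⟨z', hz'⟩ := hy.2 (j + 1)
    refine ⟨2 * z + z', ?_⟩
    rw [hz', hz, p_eq_two_mul_succ j]
    push_cast
    ring

/-- An orbit which is symmetric with respect to the origin would start from one of the countably
many heights `m / 2 * α + d`, `d` dyadic; it does not escape. -/
theorem IsEscapeSeq.two_mul_ne {α : ℝ} {m : ℤ}
    (hm : ∃ᶠ j : ℕ in Filter.atTop,
      Int.fract ((2 * j + m : ℝ) * 2 ^ j / 8 * α) ∈ Ioo (1 / 4 : ℝ) (3 / 4))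
    {y : ℕ → ℝ} (hy : IsEscapeSeq α y) (K : ℕ) (z : ℤ) : 2 * y 0 ≠ m * α + p K * z := by
  intro h0
  obtain ⟨j, hj, hf⟩ := Filter.frequently_atTop.1 hm (K + 3)
  obtain ⟨i, rfl⟩ := Nat.exists_eq_add_of_le hj
  obtain ⟨z', hz'⟩ := hy.exists_eq (K + i + 2)
  have hb := hy.1 (K + i + 2 + 1)
  have hpK := p_mul_two_pow K
  have hpj := p_mul_two_pow (K + i + 2)
  have hpj' := p_mul_two_pow (K + i + 2 + 1)
  have e : ((2 * (K + 3 + i : ℕ) + m : ℝ) * 2 ^ (K + 3 + i) / 8 * α) + ((2 ^ i * z + z' : ℤ) : ℝ)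
      = 2 ^ (K + i) * 2 * y (K + i + 2 + 1) := by
    have e1 : (2 : ℝ) ^ (K + i) * (p K * z) = 2 ^ i * z := by
      calc (2 : ℝ) ^ (K + i) * (p K * z) = (p K * 2 ^ K) * 2 ^ i * z := by ring
        _ = _ := by rw [hpK, one_mul]
    have e2 : (2 : ℝ) ^ (K + i) * (4 * p (K + i + 2) * z') = z' := by
      calc (2 : ℝ) ^ (K + i) * (4 * p (K + i + 2) * z')
          = (p (K + i + 2) * 2 ^ (K + i + 2)) * z' := by ring
        _ = _ := by rw [hpj, one_mul]
    have e3 : (2 : ℝ) ^ (K + i) * 2 * y (K + i + 2 + 1)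
        = 2 ^ (K + i) * (2 * y 0) + 2 ^ (K + i) * (2 * (((K + i + 2 : ℕ) + 1) * α))
          + 2 ^ (K + i) * (4 * p (K + i + 2) * z') := by
      rw [hz']
      ring
    rw [e3, e2, h0, mul_add, e1]
    push_cast
    ring
  have hb' : |(2 : ℝ) ^ (K + i) * 2 * y (K + i + 2 + 1)| ≤ 1 / 4 := by
    rw [abs_mul, abs_of_pos (by positivity)]
    calc (2 : ℝ) ^ (K + i) * 2 * |y (K + i + 2 + 1)|
        ≤ 2 ^ (K + i) * 2 * p (K + i + 2 + 1) := by gcongr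
      _ = (p (K + i + 2 + 1) * 2 ^ (K + i + 2 + 1)) / 4 := by ring
      _ = 1 / 4 := by rw [hpj']
  rw [← e, abs_le] at hb'
  rw [Int.fract] at hf
  set q : ℝ := (2 * (K + 3 + i : ℕ) + m : ℝ) * 2 ^ (K + 3 + i) / 8 * α
  set w : ℤ := 2 ^ i * z + z'
  have h1 : (-1 : ℝ) < ((⌊q⌋ + w : ℤ) : ℝ) := by push_cast; linarith [hf.1, hf.2]
  have h2 : ((⌊q⌋ + w : ℤ) : ℝ) < 0 := by push_cast; linarith [hf.1, hf.2]
  have h1' : -1 < ⌊q⌋ + w := by exact_mod_cast h1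
  have h2' : ⌊q⌋ + w < 0 := by exact_mod_cast h2
  omega

/-! ### Motion between the vertical lines -/

theorem h_natCast (n : ℕ) : h n = p n := by
  simp [h]

theorem h_neg_natCast_sub_one (n : ℕ) : h (-n - 1) = p n := by
  rw [h_reflect, h_natCast]

theorem h_mono_of_neg {i : ℤ} (hi : i < 0) : h i ≤ h (i + 1) := by
  obtain ⟨n, rfl⟩ : ∃ n : ℕ, i = -n - 1 := ⟨(-i - 1).toNat, by omega⟩
  rw [h_neg_natCast_sub_one]
  rcases n with _ | n
  · simp [h]
  · have e : (-((n + 1 : ℕ) : ℤ) - 1 + 1) = -n - 1 := by push_cast; ring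
    rw [e, h_neg_natCast_sub_one]
    exact p_antitone (Nat.le_add_right n 1)

theorem fibre_mono {i j : ℤ} (hij : h i ≤ h j) : fibre i ⊆ fibre j :=
  Ico_subset_Ico (neg_le_neg hij) hij

theorem wrap_eq (i : ℤ) (y : ℝ) : ∃ z : ℤ, wrap i y = y + 2 * h i * z := by
  refine ⟨-toIcoDiv (two_h_pos i) (-h i) y, ?_⟩
  unfold wrap toIcoMod
  simp only [zsmul_eq_mul]
  push_cast
  ring

theorem wrap_add_mul (i : ℤ) (y : ℝ) (z : ℤ) : wrap i (y + 2 * h i * z) = wrap i y := by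
  have := toIcoMod_add_zsmul (two_h_pos i) (-h i) y z
  rw [zsmul_eq_mul, mul_comm (z : ℝ)] at this
  exact this

theorem lineMap_zpow_add_one (α : ℝ) (n : ℤ) (s : Section) :
    (lineMap α ^ (n + 1)) s = nextLine α ((lineMap α ^ n) s) := by
  rw [add_comm, zpow_add, zpow_one]
  rfl

theorem lineMap_zpow_sub_one (α : ℝ) (n : ℤ) (s : Section) :
    (lineMap α ^ (n - 1)) s = prevLine α ((lineMap α ^ n) s) := by
  rw [sub_eq_add_neg, add_comm, zpow_add, zpow_neg_one]
  rfl

theorem col_prevLine_of_pos {α : ℝ} {s : Section} (hs : 0 ≤ s.1.1) :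
    (prevLine α s).1.1 = s.1.1 - 1 := by
  refine if_pos ?_
  obtain ⟨n, hn⟩ := Int.eq_ofNat_of_zero_le hs
  refine fibre_mono ?_ s.2
  rw [hn]
  rcases n with _ | n
  · simp [h]
  · have e : ((n + 1 : ℕ) : ℤ) - 1 = n := by push_cast; ring
    rw [e, h_natCast, h_natCast]
    exact p_antitone (Nat.le_add_right n 1)

theorem le_col_prevLine (α : ℝ) (s : Section) : s.1.1 - 1 ≤ (prevLine α s).1.1 := by
  rcases le_or_gt 0 s.1.1 with hs | hs
  · exact (col_prevLine_of_pos hs).ge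
  · change s.1.1 - 1 ≤ prevCol s.1.1 s.1.2
    unfold prevCol
    split_ifs <;> omega

theorem col_nextLine_of_neg {α : ℝ} {s : Section} (hs : s.1.1 < 0) :
    (nextLine α s).1.1 = s.1.1 + 1 :=
  if_pos (fibre_mono (h_mono_of_neg hs) (wrap_mem _ _))

theorem height_nextLine_mem (α : ℝ) (s : Section) : (nextLine α s).1.2 ∈ fibre s.1.1 :=
  wrap_mem _ _

/-- All identifications of heights are by dyadic rationals. -/
theorem height_lineMap_zpow (α : ℝ) (s : Section) (n : ℤ) :
    ∃ (K : ℕ) (z : ℤ), ((lineMap α ^ n) s).1.2 = s.1.2 + n * α + p K * z := by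
  have hdyad : ∀ (i : ℤ) (y : ℝ) (K : ℕ) (z : ℤ),
      ∃ (K' : ℕ) (z' : ℤ), wrap i (y + p K * z) = y + p K' * z' := by
    intro i y K z
    obtain ⟨w, hw⟩ := wrap_eq i (y + p K * z)
    obtain ⟨n, hn⟩ : ∃ n, h i = p n := by
      unfold h
      split_ifs <;> exact ⟨_, rfl⟩
    refine ⟨K + n, 2 ^ n * z + 2 * 2 ^ K * w, ?_⟩
    have h1 := p_mul_two_pow n
    have h2 := p_mul_two_pow K
    have h3 : p (K + n) = p K * p n := pow_add _ _ _
    rw [hw, hn, h3]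
    push_cast
    linear_combination (-(p K * z)) * h1 - (2 * p n * w) * h2
  induction n with
  | zero => exact ⟨0, 0, by simp⟩
  | succ n ih =>
    obtain ⟨K, z, hz⟩ := ih
    rw [lineMap_zpow_add_one]
    set t := (lineMap α ^ (n : ℤ)) s
    change ∃ (K : ℕ) (z : ℤ), wrap t.1.1 (t.1.2 + α) = _
    obtain ⟨K', z', h'⟩ := hdyad t.1.1 (s.1.2 + (n + 1 : ℤ) * α) K z
    refine ⟨K', z', ?_⟩
    rw [← h', hz]
    congr 1
    push_cast
    ring
  | pred n ih =>
    obtain ⟨K, z, hz⟩ := ih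
    rw [lineMap_zpow_sub_one]
    set t := (lineMap α ^ (-n : ℤ)) s
    change ∃ (K : ℕ) (z : ℤ), wrap (prevCol t.1.1 t.1.2) (t.1.2 - α) = _
    obtain ⟨K', z', h'⟩ := hdyad (prevCol t.1.1 t.1.2) (s.1.2 + (-n - 1 : ℤ) * α) K z
    refine ⟨K', z', ?_⟩
    rw [← h', hz]
    congr 1
    push_cast
    ring

/-! ### Escape sequences and orbits of the first return map -/

/-- If the columns eventually increase one by one, the orbit has crossed the line `X = 0` for a last
time; from there on, its heights form an escape sequence. -/
theorem exists_isEscapeSeq_of_col {α : ℝ} {s : Section} {N : ℤ}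
    (hs : ∀ n ≥ N, 0 ≤ ((lineMap α ^ n) s).1.1 ∧
      ((lineMap α ^ (n + 1)) s).1.1 = ((lineMap α ^ n) s).1.1 + 1) :
    ∃ (n : ℤ) (y : ℕ → ℝ), IsEscapeSeq α y ∧
      ∀ j : ℕ, ((lineMap α ^ (n + j)) s).1 = ((j : ℤ), y j) := by
  obtain ⟨K, hK⟩ := Int.eq_ofNat_of_zero_le (hs N le_rfl).1
  have hback : ∀ k : ℕ, k ≤ K → ((lineMap α ^ (N - k)) s).1.1 = (K : ℤ) - k := by
    intro k
    induction k with
    | zero => intro _; simpa using hK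
    | succ k ih =>
      intro hk
      have ih := ih (by omega)
      have e : N - ((k + 1 : ℕ) : ℤ) = N - k - 1 := by push_cast; ring
      rw [e, lineMap_zpow_sub_one, col_prevLine_of_pos (by omega), ih]
      push_cast
      ring
  have hfwd : ∀ k : ℕ, ((lineMap α ^ (N + k)) s).1.1 = (K : ℤ) + k := by
    intro k
    induction k with
    | zero => simpa using hK
    | succ k ih =>
      have e : N + ((k + 1 : ℕ) : ℤ) = N + k + 1 := by push_cast; ring
      rw [e, (hs (N + k) (by omega)).2, ih]
      push_cast
      ring
  have hcol : ∀ j : ℕ, ((lineMap α ^ (N - K + j)) s).1.1 = j := by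
    intro j
    rcases le_total j K with hj | hj
    · have := hback (K - j) (by omega)
      have e : N - ((K - j : ℕ) : ℤ) = N - K + j := by omega
      rw [e] at this
      omega
    · have := hfwd (j - K)
      have e : N + ((j - K : ℕ) : ℤ) = N - K + j := by omega
      rw [e] at this
      omega
  refine ⟨N - K, fun j => ((lineMap α ^ (N - K + j)) s).1.2, ⟨fun j => ?_, fun j => ?_⟩,
    fun j => Prod.ext (hcol j) rfl⟩
  · have := ((lineMap α ^ (N - K + j)) s).2
    rw [hcol j] at this
    rw [← h_natCast]
    exact abs_le.2 ⟨this.1, this.2.le⟩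
  · have e : N - K + ((j + 1 : ℕ) : ℤ) = N - K + j + 1 := by push_cast; ring
    have hc := hcol j
    simp only [e, lineMap_zpow_add_one]
    set t := (lineMap α ^ (N - K + j)) s
    obtain ⟨z, hz⟩ := wrap_eq t.1.1 (t.1.2 + α)
    rw [hc, h_natCast] at hz
    refine ⟨z, ?_⟩
    change wrap t.1.1 (t.1.2 + α) = _
    rw [hc]
    exact hz

/-- The counterpart of `exists_isEscapeSeq_of_col` for the past: the heights, read backwards from
the first crossing of `X = 0`, form an escape sequence of the slope `-α`. -/
theorem exists_isEscapeSeq_neg_of_col {α : ℝ} {s : Section} {N : ℤ}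
    (hs : ∀ n ≤ N, ((lineMap α ^ n) s).1.1 < 0 ∧
      ((lineMap α ^ (n - 1)) s).1.1 = ((lineMap α ^ n) s).1.1 - 1) :
    ∃ (n : ℤ) (y : ℕ → ℝ), IsEscapeSeq (-α) y ∧ ((lineMap α ^ n) s).1.2 = y 0 := by
  obtain ⟨K, hK⟩ : ∃ K : ℕ, ((lineMap α ^ N) s).1.1 = -K :=
    ⟨(-((lineMap α ^ N) s).1.1).toNat, by have := (hs N le_rfl).1; omega⟩
  have hback : ∀ k : ℕ, ((lineMap α ^ (N - k)) s).1.1 = -(K : ℤ) - k := by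
    intro k
    induction k with
    | zero => simpa using hK
    | succ k ih =>
      have e : N - ((k + 1 : ℕ) : ℤ) = N - k - 1 := by push_cast; ring
      rw [e, (hs (N - k) (by omega)).2, ih]
      push_cast
      ring
  have hfwd : ∀ k : ℕ, k ≤ K → ((lineMap α ^ (N + k)) s).1.1 = -(K : ℤ) + k := by
    intro k
    induction k with
    | zero => intro _; simpa using hK
    | succ k ih =>
      intro hk
      have ih := ih (by omega)
      have e : N + ((k + 1 : ℕ) : ℤ) = N + k + 1 := by push_cast; ring
      rw [e, lineMap_zpow_add_one, col_nextLine_of_neg (by omega), ih]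
      push_cast
      ring
  have hcol : ∀ j : ℕ, ((lineMap α ^ (N + K - j)) s).1.1 = -j := by
    intro j
    rcases le_total j K with hj | hj
    · have := hfwd (K - j) (by omega)
      have e : N + ((K - j : ℕ) : ℤ) = N + K - j := by omega
      rw [e] at this
      omega
    · have := hback (j - K)
      have e : N - ((j - K : ℕ) : ℤ) = N + K - j := by omega
      rw [e] at this
      omega
  have hnext : ∀ j : ℕ, (lineMap α ^ (N + K - j)) s =
      nextLine α ((lineMap α ^ (N + K - (j + 1 : ℕ))) s) := by
    intro j
    rw [← lineMap_zpow_add_one]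
    congr 2
    push_cast
    ring
  have hh : ∀ j : ℕ, h ((lineMap α ^ (N + K - (j + 1 : ℕ))) s).1.1 = p j := by
    intro j
    rw [hcol, ← h_neg_natCast_sub_one]
    congr 1
    push_cast
    ring
  refine ⟨N + K, fun j => ((lineMap α ^ (N + K - j)) s).1.2, ⟨fun j => ?_, fun j => ?_⟩, by simp⟩
  · have := height_nextLine_mem α ((lineMap α ^ (N + K - (j + 1 : ℕ))) s)
    rw [← hnext] at this
    rw [← hh j]
    exact abs_le.2 ⟨this.1, this.2.le⟩
  · have hn := hnext j
    have hhj := hh j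
    simp only
    set t := (lineMap α ^ (N + K - (j + 1 : ℕ))) s
    obtain ⟨z, hz⟩ := wrap_eq t.1.1 (t.1.2 + α)
    rw [hhj] at hz
    refine ⟨-z, ?_⟩
    rw [hn]
    change _ = wrap t.1.1 (t.1.2 + α) + _ + _
    rw [hz]
    push_cast
    ring

/-- The point of height `y j` on the line `X = j`. -/
def escapePoint (y : ℕ → ℝ) (hlt : ∀ j, |y j| < p j) (j : ℕ) : Section :=
  ⟨((j : ℤ), y j), by
    have := abs_lt.1 (hlt j)
    change y j ∈ fibre j
    rw [fibre, h_natCast]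
    exact ⟨this.1.le, this.2⟩⟩

theorem nextLine_escapePoint {α : ℝ} {y : ℕ → ℝ} (hlt : ∀ j, |y j| < p j)
    (hy : IsEscapeSeq α y) (j : ℕ) :
    nextLine α (escapePoint y hlt j) = escapePoint y hlt (j + 1) := by
  obtain ⟨z, hz⟩ := hy.2 j
  have hmem := (escapePoint y hlt (j + 1)).2
  change y (j + 1) ∈ fibre ((j + 1 : ℕ) : ℤ) at hmem
  have hsub : fibre ((j + 1 : ℕ) : ℤ) ⊆ fibre j := by
    refine fibre_mono ?_
    rw [h_natCast, h_natCast]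
    exact p_antitone (Nat.le_add_right j 1)
  have e : wrap j (y j + α) = y (j + 1) := by
    have e1 : y j + α = y (j + 1) + 2 * h j * ((-z : ℤ) : ℝ) := by
      rw [hz, h_natCast]
      push_cast
      ring
    rw [e1, wrap_add_mul, wrap_eq_self (hsub hmem)]
  apply Subtype.ext
  change (nextCol ((j : ℤ) + 1) (wrap j (y j + α)), wrap j (y j + α))
    = (((j + 1 : ℕ) : ℤ), y (j + 1))
  rw [e]
  have : nextCol ((j : ℤ) + 1) (y (j + 1)) = (j : ℤ) + 1 := if_pos (by exact_mod_cast hmem)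
  rw [this]
  push_cast
  rfl

theorem lineMap_zpow_escapePoint {α : ℝ} {y : ℕ → ℝ} (hlt : ∀ j, |y j| < p j)
    (hy : IsEscapeSeq α y) (j : ℕ) :
    (lineMap α ^ (j : ℤ)) (escapePoint y hlt 0) = escapePoint y hlt j := by
  induction j with
  | zero => rfl
  | succ j ih =>
    push_cast
    rw [lineMap_zpow_add_one, ih, nextLine_escapePoint hlt hy]

/-! ### Backward orbits leave every bounded part of the surface -/

/-- The backward motion translates the segment from `x` to `x + e` if it contains, besides `x`, no
end of an aperture and no point that moves to the lower end of a fibre. -/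
theorem prev_add_of_no_singularity {α : ℝ} {i : ℤ} {x e : ℝ} (he : 0 ≤ e)
    (h1 : ∀ e' ∈ Ioc 0 e, x + e' ≠ h (i - 1) ∧ x + e' ≠ -h (i - 1))
    (h2 : ∀ e' ∈ Ioc 0 e, wrap (prevCol i (x + e')) (x + e' - α) ≠ -h (prevCol i (x + e'))) :
    prevCol i (x + e) = prevCol i x ∧
      wrap (prevCol i x) (x + e - α) = wrap (prevCol i x) (x - α) + e := by
  have hcol : ∀ e', 0 ≤ e' → e' ≤ e → prevCol i (x + e') = prevCol i x := by
    intro e' he0 he'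
    have hiff : x + e' ∈ fibre (i - 1) ↔ x ∈ fibre (i - 1) := by
      unfold fibre
      constructor
      · rintro ⟨h3, h4⟩
        refine ⟨?_, by linarith⟩
        by_contra! hcon
        exact (h1 (-h (i - 1) - x) ⟨by linarith, by linarith⟩).2 (by ring)
      · rintro ⟨h3, h4⟩
        refine ⟨by linarith, ?_⟩
        by_contra! hcon
        exact (h1 (h (i - 1) - x) ⟨by linarith, by linarith⟩).1 (by ring)
    classical exact if_congr hiff rfl rfl
  refine ⟨hcol e he le_rfl, ?_⟩
  set j := prevCol i x
  have hw := wrap_mem j (x - α)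
  set w := wrap j (x - α) with hwdef
  have hadd : ∀ e', wrap j (x + e' - α) = wrap j (w + e') := by
    intro e'
    rw [hwdef, wrap_wrap_add]
    congr 1
    ring
  rw [hadd]
  refine wrap_eq_self ⟨by linarith [hw.1], ?_⟩
  by_contra! hcon
  have he0 : 0 ≤ h j - w := by linarith [hw.2]
  have hj := hcol (h j - w) he0 (by linarith)
  refine h2 (h j - w) ⟨by linarith [hw.2], by linarith⟩ ?_
  rw [hj, hadd]
  have e1 : w + (h j - w) = -h j + 2 * h j * ((1 : ℤ) : ℝ) := by
    push_cast
    ring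
  rw [e1, wrap_add_mul]
  have := h_pos j
  exact wrap_eq_self ⟨le_rfl, by linarith⟩

theorem prevLine_injective (α : ℝ) : Function.Injective (prevLine α) :=
  (lineMap α).symm.injective

theorem col_prevLine_eq_or {α : ℝ} {M : ℕ} {s : Section} (h1 : -(M : ℤ) ≤ s.1.1)
    (h2 : s.1.1 ≤ M) :
    (prevLine α s).1.1 = -(M : ℤ) - 1 ∨
      (-(M : ℤ) ≤ (prevLine α s).1.1 ∧ (prevLine α s).1.1 < M) := by
  rcases le_or_gt 0 s.1.1 with hs | hs
  · rw [col_prevLine_of_pos hs]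
    omega
  · change prevCol s.1.1 s.1.2 = _ ∨ (_ ≤ prevCol s.1.1 s.1.2 ∧ prevCol s.1.1 s.1.2 < _)
    unfold prevCol
    split_ifs <;> omega

theorem h_le_one (i : ℤ) : h i ≤ 1 := by
  unfold h p
  split_ifs <;> exact pow_le_one₀ (by norm_num) (by norm_num)

/-- Every backward orbit from the column `M` passes through the opposite aperture, into the column
`-M - 1`. Otherwise it would remain in the columns `-M, …, M - 1`; as these contain finitely many
vertices, and each vertex reaches the column `M` at most once before leaving them, a short interval
above the starting point is never cut, and its infinitely many disjoint translates do not fit. -/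
theorem exists_prevLine_iterate_col_eq (α : ℝ) (M : ℕ) (s : Section) (hs : s.1.1 = M) :
    ∃ k : ℕ, ((prevLine α)^[k] s).1.1 = -(M : ℤ) - 1 := by
  by_contra! hne
  set F := prevLine α with hF
  have hFinj : Function.Injective F := prevLine_injective α
  obtain ⟨⟨i₀, y⟩, hy⟩ := s
  obtain rfl : i₀ = M := hs
  set s : Section := ⟨((M : ℤ), y), hy⟩
  have hyM : y < p M := by
    have := hy.2
    simp only [h_natCast] at this
    exact this
  have hregion : ∀ t : ℕ, -(M : ℤ) ≤ (F^[t] s).1.1 ∧ (F^[t] s).1.1 ≤ M ∧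
      (1 ≤ t → (F^[t] s).1.1 < M) := by
    intro t
    induction t with
    | zero =>
      change -(M : ℤ) ≤ M ∧ (M : ℤ) ≤ M ∧ (1 ≤ 0 → (M : ℤ) < M)
      omega
    | succ t ih =>
      rw [Function.iterate_succ_apply']
      rcases col_prevLine_eq_or (α := α) ih.1 ih.2.1 with h3 | h3
      · exact absurd (by rw [Function.iterate_succ_apply']; exact h3) (hne (t + 1))
      · exact ⟨h3.1, h3.2.le, fun _ => h3.2⟩
  -- The points of the columns `-M, …, M` next to which `F` is not a translation.
  set V : Set Section :=
    Subtype.val ⁻¹' ((fun i : ℤ => (i, h (i - 1))) '' Icc (-(M : ℤ)) M ∪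
      (fun i : ℤ => (i, -h (i - 1))) '' Icc (-(M : ℤ)) M) ∪
    F ⁻¹' (Subtype.val ⁻¹' ((fun i : ℤ => (i, -h i)) '' Icc (-(M : ℤ) - 1) M))
  have hVfin : V.Finite := by
    refine Set.Finite.union ?_ ?_
    · exact Set.Finite.preimage Subtype.val_injective.injOn
        (((finite_Icc _ _).image _).union ((finite_Icc _ _).image _))
    · exact Set.Finite.preimage hFinj.injOn
        (Set.Finite.preimage Subtype.val_injective.injOn ((finite_Icc _ _).image _))
  -- The displacements `e` such that the orbit of `(M, y + e)` meets one of them.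
  set B : Set ℝ := {e | ∃ (s' : Section) (t : ℕ), s'.1 = ((M : ℤ), y + e) ∧ F^[t] s' ∈ V ∧
    ∀ j, 1 ≤ j → j ≤ t → (F^[j] s').1.1 < M}
  have hBfin : B.Finite := by
    have : Nonempty Section := ⟨s⟩
    choose! σ τ hσ hστ hτ using fun e (he : e ∈ B) => he
    refine Set.Finite.of_injOn (f := fun e => F^[τ e] (σ e)) (fun e he => hστ e he) ?_ hVfin
    have aux : ∀ e ∈ B, ∀ e' ∈ B, τ e ≤ τ e' → F^[τ e] (σ e) = F^[τ e'] (σ e') → e = e' := by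
      intro e he e' he' hle heq
      obtain ⟨k, hk⟩ := Nat.exists_eq_add_of_le hle
      rw [hk, Function.iterate_add_apply] at heq
      have h3 := hFinj.iterate (τ e) heq
      rcases Nat.eq_zero_or_pos k with rfl | hk0
      · have h4 := congrArg (fun u : Section => u.1.2) h3
        simp only [Function.iterate_zero, id, hσ e he, hσ e' he'] at h4
        linarith
      · have h4 := congrArg (fun u : Section => u.1.1) h3
        have h5 := hτ e' he' k hk0 (by omega)
        simp only [hσ e he] at h4
        omega
    intro e he e' he' heq
    rcases le_total (τ e) (τ e') with hle | hle
    · exact aux e he e' he' hle heq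
    · exact (aux e' he' e he hle heq.symm).symm
  obtain ⟨ε, hε, hεM, hεB⟩ : ∃ ε > 0, y + ε ≤ p M ∧ ∀ e ∈ Ioo 0 ε, e ∉ B := by
    have hcl : IsClosed (B \ {0}) := (hBfin.subset sdiff_subset).isClosed
    obtain ⟨ε, hε, hball⟩ := Metric.isOpen_iff.1 hcl.isOpen_compl 0 (by simp)
    refine ⟨min ε (p M - y), lt_min hε (by linarith), by linarith [min_le_right ε (p M - y)],
      fun e he heB => ?_⟩
    refine hball (?_ : e ∈ Metric.ball 0 ε) ⟨heB, he.1.ne'⟩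
    rw [Metric.mem_ball, Real.dist_eq, sub_zero, abs_of_pos he.1]
    exact he.2.trans_le (min_le_left _ _)
  have hpoint : ∀ e ∈ Ico 0 ε, ∃ s' : Section, s'.1 = ((M : ℤ), y + e) := by
    intro e he
    refine ⟨⟨((M : ℤ), y + e), ?_⟩, rfl⟩
    have h3 := hy.1
    simp only at h3 ⊢
    rw [fibre, h_natCast] at *
    exact ⟨by linarith [he.1], by linarith [he.2]⟩
  have htrans : ∀ t : ℕ, ∀ e ∈ Ico 0 ε, ∀ s' : Section, s'.1 = ((M : ℤ), y + e) →
      (F^[t] s').1 = ((F^[t] s).1.1, (F^[t] s).1.2 + e) := by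
    intro t
    induction t using Nat.strong_induction_on with
    | _ t ih =>
    rcases t with _ | t
    · intro e _ s' hs'
      exact hs'
    intro e he s' hs'
    have hnotV : ∀ e' ∈ Ioc 0 e, ∀ s'' : Section, s''.1 = ((M : ℤ), y + e') →
        F^[t] s'' ∉ V := by
      intro e' he' s'' hs'' hmem
      refine hεB e' ⟨he'.1, he'.2.trans_lt he.2⟩ ⟨s'', t, hs'', hmem, fun j hj1 hj2 => ?_⟩
      rw [ih j (by omega) e' ⟨he'.1.le, he'.2.trans_lt he.2⟩ s'' hs'']
      exact (hregion j).2.2 hj1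
    have hreg := hregion t
    have hstep := prev_add_of_no_singularity (α := α) (i := (F^[t] s).1.1) (x := (F^[t] s).1.2)
      (e := e) he.1 ?_ ?_
    · have ht := ih t (by omega) e he s' hs'
      rw [Function.iterate_succ_apply', Function.iterate_succ_apply']
      set u := F^[t] s
      set u' := F^[t] s'
      change (prevCol u'.1.1 u'.1.2, wrap (prevCol u'.1.1 u'.1.2) (u'.1.2 - α))
        = (prevCol u.1.1 u.1.2, wrap (prevCol u.1.1 u.1.2) (u.1.2 - α) + e)
      rw [ht, hstep.1, hstep.2]
    · intro e' he'
      obtain ⟨s'', hs''⟩ := hpoint e' ⟨he'.1.le, he'.2.trans_lt he.2⟩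
      have ht := ih t (by omega) e' ⟨he'.1.le, he'.2.trans_lt he.2⟩ s'' hs''
      have hn := hnotV e' he' s'' hs''
      constructor
      · intro h3
        refine hn (Or.inl (Or.inl ⟨(F^[t] s).1.1, ⟨hreg.1, hreg.2.1⟩, ?_⟩))
        rw [ht, h3]
      · intro h3
        refine hn (Or.inl (Or.inr ⟨(F^[t] s).1.1, ⟨hreg.1, hreg.2.1⟩, ?_⟩))
        rw [ht, h3]
    · intro e' he' h3
      obtain ⟨s'', hs''⟩ := hpoint e' ⟨he'.1.le, he'.2.trans_lt he.2⟩
      have ht := ih t (by omega) e' ⟨he'.1.le, he'.2.trans_lt he.2⟩ s'' hs''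
      have hn := hnotV e' he' s'' hs''
      have hcol : prevCol (F^[t] s).1.1 ((F^[t] s).1.2 + e') = (F (F^[t] s'')).1.1 := by
        change _ = prevCol (F^[t] s'').1.1 (F^[t] s'').1.2
        rw [ht]
      have hht : wrap (prevCol (F^[t] s).1.1 ((F^[t] s).1.2 + e')) ((F^[t] s).1.2 + e' - α)
          = (F (F^[t] s'')).1.2 := by
        change _ = wrap (prevCol (F^[t] s'').1.1 (F^[t] s'').1.2) ((F^[t] s'').1.2 - α)
        rw [ht]
      rw [hht, hcol] at h3
      have hr : -(M : ℤ) ≤ (F^[t] s'').1.1 ∧ (F^[t] s'').1.1 ≤ M := by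
        rw [ht]
        exact ⟨hreg.1, hreg.2.1⟩
      refine hn (Or.inr ⟨(F (F^[t] s'')).1.1, ?_, ?_⟩)
      · rcases col_prevLine_eq_or (α := α) hr.1 hr.2 with h4 | h4
        · rw [← hF] at h4
          rw [mem_Icc]
          omega
        · rw [← hF] at h4
          rw [mem_Icc]
          omega
      · exact Prod.ext rfl h3.symm
  -- Infinitely many translates of an interval of length `ε` do not fit in finitely many columns,
  -- hence two of them overlap.
  obtain ⟨t, t', htt, e, he, heq⟩ : ∃ t t' : ℕ, t ≠ t' ∧ ∃ e ∈ Ico 0 ε,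
      (F^[t'] s).1 = ((F^[t] s).1.1, (F^[t] s).1.2 + e) := by
    obtain ⟨t, _, t', _, hne', heq⟩ := Set.infinite_univ.exists_ne_map_eq_of_mapsTo
      (f := fun t : ℕ => ((F^[t] s).1.1, ⌊(F^[t] s).1.2 / ε⌋))
      (t := Icc (-(M : ℤ)) M ×ˢ Icc ⌊-1 / ε⌋ ⌊1 / ε⌋) (fun t _ => by
        have hm := (F^[t] s).2
        have h1 := h_le_one (F^[t] s).1.1
        refine ⟨⟨(hregion t).1, (hregion t).2.1⟩, Int.floor_le_floor ?_, Int.floor_le_floor ?_⟩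
        · exact div_le_div_of_nonneg_right (by linarith [hm.1]) hε.le
        · exact div_le_div_of_nonneg_right (by linarith [hm.2]) hε.le)
      ((finite_Icc _ _).prod (finite_Icc _ _))
    simp only [Prod.mk.injEq] at heq
    obtain ⟨hc, hfl⟩ := heq
    have hlt := Int.abs_sub_lt_one_of_floor_eq_floor hfl
    rw [← sub_div, abs_div, abs_of_pos hε, div_lt_one hε] at hlt
    rcases le_total (F^[t] s).1.2 (F^[t'] s).1.2 with hle | hle
    · refine ⟨t, t', hne', (F^[t'] s).1.2 - (F^[t] s).1.2, ⟨by linarith, ?_⟩, ?_⟩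
      · rw [abs_sub_comm] at hlt
        exact (le_abs_self _).trans_lt hlt
      · exact Prod.ext hc.symm (by simp)
    · refine ⟨t', t, hne'.symm, (F^[t] s).1.2 - (F^[t'] s).1.2, ⟨by linarith, ?_⟩, ?_⟩
      · exact (le_abs_self _).trans_lt hlt
      · exact Prod.ext hc (by simp)
  obtain ⟨s', hs'⟩ := hpoint e he
  have heq' : F^[t] s' = F^[t'] s := Subtype.ext ((htrans t e he s' hs').trans heq.symm)
  -- Pulled forward, the overlap takes place in the column `M`, to which `F` does not return.
  rcases Nat.lt_or_gt_of_ne htt with hlt | hlt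
  · obtain ⟨k, rfl⟩ := Nat.exists_eq_add_of_lt hlt
    rw [add_assoc, Function.iterate_add_apply] at heq'
    have h3 := congrArg (fun u : Section => u.1.1) (hFinj.iterate t heq')
    simp only [hs'] at h3
    have := (hregion (k + 1)).2.2 (by omega)
    omega
  · obtain ⟨k, rfl⟩ := Nat.exists_eq_add_of_lt hlt
    rw [add_assoc, Function.iterate_add_apply] at heq'
    have h3 := congrArg (fun u : Section => u.1.1) (hFinj.iterate t' heq')
    have h4 := htrans (k + 1) e he s' hs'
    simp only [h4] at h3
    have := (hregion (k + 1)).2.2 (by omega)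
    have h5 : s.1.1 = M := rfl
    omega

/-! ### The flow and its return map -/

theorem speedX_pos (α : ℝ) : 0 < speedX α := by
  unfold speedX
  positivity

theorem floor_advance (α : ℝ) (s : Section) (u : Ico (0 : ℝ) 1) :
    ⌊(advance α s u).1.1⌋ = s.1.1 := by
  change ⌊(s.1.1 : ℝ) + u⌋ = s.1.1
  rw [Int.floor_intCast_add, Int.floor_eq_zero_iff.2 u.2, add_zero]

theorem fract_advance (α : ℝ) (s : Section) (u : Ico (0 : ℝ) 1) :
    Int.fract (advance α s u).1.1 = u := by
  change Int.fract ((s.1.1 : ℝ) + u) = u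
  rw [Int.fract_intCast_add, Int.fract_eq_self.2 u.2]

theorem entry_advance (α : ℝ) (s : Section) (u : Ico (0 : ℝ) 1) :
    entry α (advance α s u) = s := by
  apply Subtype.ext
  change (⌊(advance α s u).1.1⌋, wrap ⌊(advance α s u).1.1⌋
    ((advance α s u).1.2 - α * Int.fract (advance α s u).1.1)) = s.1
  rw [floor_advance, fract_advance]
  change (s.1.1, wrap s.1.1 (wrap s.1.1 (s.1.2 + α * u) - α * u)) = s.1
  rw [sub_eq_add_neg, wrap_wrap_add, add_neg_cancel_right, wrap_eq_self s.2]

theorem advance_entry (α : ℝ) (z : Surface) :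
    advance α (entry α z) ⟨Int.fract z.1.1, Int.fract_nonneg _, Int.fract_lt_one _⟩ = z := by
  apply Subtype.ext
  change ((⌊z.1.1⌋ : ℝ) + Int.fract z.1.1, wrap ⌊z.1.1⌋
    (wrap ⌊z.1.1⌋ (z.1.2 - α * Int.fract z.1.1) + α * Int.fract z.1.1)) = z.1
  rw [Int.floor_add_fract, wrap_wrap_add, sub_add_cancel, wrap_eq_self z.2]

theorem flow_eq (α t : ℝ) (z : Surface) {u : ℝ} (hu : u = Int.fract z.1.1 + t * speedX α) :
    flow α t z = advance α ((lineMap α ^ ⌊u⌋) (entry α z))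
      ⟨Int.fract u, Int.fract_nonneg u, Int.fract_lt_one u⟩ := by
  subst hu
  rfl

theorem entry_flow (α t : ℝ) (z : Surface) :
    entry α (flow α t z) = (lineMap α ^ ⌊Int.fract z.1.1 + t * speedX α⌋) (entry α z) := by
  rw [flow_eq α t z rfl, entry_advance]

theorem flow_add (α s t : ℝ) (z : Surface) : flow α (s + t) z = flow α s (flow α t z) := by
  set u := Int.fract z.1.1 + t * speedX α with hu
  have hf : Int.fract (flow α t z).1.1 = Int.fract u := by
    rw [flow_eq α t z hu, fract_advance]
  have e : Int.fract z.1.1 + (s + t) * speedX α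
      = (Int.fract u + s * speedX α) + (⌊u⌋ : ℤ) := by
    have := Int.floor_add_fract u
    rw [add_mul]
    linarith
  rw [flow_eq α (s + t) z rfl, flow_eq α s (flow α t z) rfl, entry_flow, hf, ← hu,
    ← Equiv.Perm.mul_apply, ← zpow_add]
  simp only [e, Int.floor_add_intCast, Int.fract_add_intCast]

theorem orbit_flow (α t : ℝ) (z : Surface) : orbit α (flow α t z) = orbit α z := by
  ext w
  constructor
  · rintro ⟨s, rfl⟩
    exact ⟨s + t, flow_add α s t z⟩
  · rintro ⟨s, rfl⟩
    refine ⟨s - t, ?_⟩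
    change flow α (s - t) (flow α t z) = flow α s z
    rw [← flow_add, sub_add_cancel]

theorem fract_add_time_mul_speedX (α : ℝ) (z : Surface) (u : ℝ) :
    Int.fract z.1.1 + ((u - Int.fract z.1.1) / speedX α) * speedX α = u := by
  rw [div_mul_cancel₀ _ (speedX_pos α).ne']
  ring

theorem position_fst (α t : ℝ) (z : Surface) {u : ℝ} (hu : u = Int.fract z.1.1 + t * speedX α) :
    (position α z t).1 = |(((lineMap α ^ ⌊u⌋) (entry α z)).1.1 : ℝ) + Int.fract u| := by
  rw [position, flow_eq α t z hu]
  rfl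

theorem position_fst_time (α : ℝ) (z : Surface) (n : ℤ) {f : ℝ} (hf : f ∈ Ico (0 : ℝ) 1) :
    (position α z ((n + f - Int.fract z.1.1) / speedX α)).1
      = |(((lineMap α ^ n) (entry α z)).1.1 : ℝ) + f| := by
  rw [position_fst α _ z (fract_add_time_mul_speedX α z (n + f)).symm, Int.floor_intCast_add,
    Int.floor_eq_zero_iff.2 hf, Int.fract_intCast_add, Int.fract_eq_self.2 hf, add_zero]

theorem EscapesForward.exists_col {α : ℝ} {z : Surface} (hz : EscapesForward α z) :
    ∃ N : ℤ, ∀ n ≥ N, 0 ≤ ((lineMap α ^ n) (entry α z)).1.1 ∧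
      ((lineMap α ^ (n + 1)) (entry α z)).1.1 = ((lineMap α ^ n) (entry α z)).1.1 + 1 := by
  obtain ⟨T, hT⟩ := hz
  have hσ := speedX_pos α
  set c : ℝ := (position α z T).1 - T * speedX α - Int.fract z.1.1
  obtain ⟨N, hN⟩ := exists_int_gt (T * speedX α + Int.fract z.1.1)
  have hpos : ∀ n ≥ N, ∀ f ∈ Ico (0 : ℝ) 1,
      |(((lineMap α ^ n) (entry α z)).1.1 : ℝ) + f| = c + n + f := by
    intro n hn f hf
    rw [← position_fst_time α z n hf, hT]
    · simp only [c]
      rw [sub_mul, div_mul_cancel₀ _ hσ.ne']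
      ring
    · have : (N : ℝ) ≤ n := by exact_mod_cast hn
      rw [ge_iff_le, le_div_iff₀ hσ]
      linarith [hf.1]
  have hcol : ∀ n ≥ N, 0 ≤ ((lineMap α ^ n) (entry α z)).1.1 ∧
      (((lineMap α ^ n) (entry α z)).1.1 : ℝ) = c + n := by
    intro n hn
    have h0 := hpos n hn 0 (by norm_num)
    have h1 := hpos n hn (1 / 2) (by norm_num)
    set i := ((lineMap α ^ n) (entry α z)).1.1
    have hi : 0 ≤ i := by
      by_contra! hcon
      have h3 : (i : ℝ) ≤ -1 := by exact_mod_cast (show i ≤ -1 by omega)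
      rw [abs_of_nonpos (by linarith)] at h0
      rw [abs_of_nonpos (by linarith)] at h1
      linarith
    have h4 : (0 : ℝ) ≤ i := by exact_mod_cast hi
    rw [abs_of_nonneg (by linarith)] at h0
    exact ⟨hi, by linarith⟩
  refine ⟨N, fun n hn => ⟨(hcol n hn).1, ?_⟩⟩
  have h1 := (hcol n hn).2
  have h2 := (hcol (n + 1) (by omega)).2
  have h3 : (((lineMap α ^ (n + 1)) (entry α z)).1.1 : ℝ)
      = ((((lineMap α ^ n) (entry α z)).1.1 + 1 : ℤ) : ℝ) := by
    push_cast at h2 ⊢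
    linarith
  exact_mod_cast h3

theorem EscapesBackward.exists_col {α : ℝ} {z : Surface} (hz : EscapesBackward α z) :
    ∃ N : ℤ, ∀ n ≤ N, ((lineMap α ^ n) (entry α z)).1.1 < 0 ∧
      ((lineMap α ^ (n - 1)) (entry α z)).1.1 = ((lineMap α ^ n) (entry α z)).1.1 - 1 := by
  obtain ⟨T, hT⟩ := hz
  have hσ := speedX_pos α
  set c : ℝ := (position α z T).1 + T * speedX α + Int.fract z.1.1
  obtain ⟨N, hN⟩ := exists_int_lt (T * speedX α + Int.fract z.1.1 - 1)
  have hpos : ∀ n ≤ N, ∀ f ∈ Ico (0 : ℝ) 1,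
      |(((lineMap α ^ n) (entry α z)).1.1 : ℝ) + f| = c - n - f := by
    intro n hn f hf
    rw [← position_fst_time α z n hf, hT]
    · simp only [c]
      rw [sub_mul, div_mul_cancel₀ _ hσ.ne']
      ring
    · have : (n : ℝ) ≤ N := by exact_mod_cast hn
      rw [div_le_iff₀ hσ]
      linarith [hf.2]
  have hcol : ∀ n ≤ N, ((lineMap α ^ n) (entry α z)).1.1 < 0 ∧
      (((lineMap α ^ n) (entry α z)).1.1 : ℝ) = n - c := by
    intro n hn
    have h0 := hpos n hn 0 (by norm_num)
    have h1 := hpos n hn (1 / 2) (by norm_num)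
    set i := ((lineMap α ^ n) (entry α z)).1.1
    have hi : i < 0 := by
      by_contra! hcon
      have h3 : (0 : ℝ) ≤ i := by exact_mod_cast hcon
      rw [abs_of_nonneg (by linarith)] at h0
      rw [abs_of_nonneg (by linarith)] at h1
      linarith
    have h4 : (i : ℝ) ≤ -1 := by exact_mod_cast (show i ≤ -1 by omega)
    rw [abs_of_nonpos (by linarith)] at h0
    exact ⟨hi, by linarith⟩
  refine ⟨N, fun n hn => ⟨(hcol n hn).1, ?_⟩⟩
  have h1 := (hcol n hn).2
  have h2 := (hcol (n - 1) (by omega)).2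
  have h3 : (((lineMap α ^ (n - 1)) (entry α z)).1.1 : ℝ)
      = ((((lineMap α ^ n) (entry α z)).1.1 - 1 : ℤ) : ℝ) := by
    push_cast at h2 ⊢
    linarith
  exact_mod_cast h3

theorem escapesForward_of_entry {α : ℝ} {y : ℕ → ℝ} (hlt : ∀ j, |y j| < p j)
    (hy : IsEscapeSeq α y) {z : Surface} (hz : entry α z = escapePoint y hlt 0) :
    EscapesForward α z := by
  have hσ := speedX_pos α
  have hpos : ∀ t ≥ 0, (position α z t).1 = Int.fract z.1.1 + t * speedX α := by
    intro t ht
    set u := Int.fract z.1.1 + t * speedX α with hu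
    have hu0 : 0 ≤ u := add_nonneg (Int.fract_nonneg _) (mul_nonneg ht hσ.le)
    obtain ⟨k, hk⟩ := Int.eq_ofNat_of_zero_le (Int.floor_nonneg.2 hu0)
    have hfl := Int.floor_add_fract u
    rw [position_fst α t z hu, hz, hk, lineMap_zpow_escapePoint hlt hy]
    change |(((k : ℤ)) : ℝ) + Int.fract u| = u
    rw [← hk, hfl, abs_of_nonneg hu0]
  refine ⟨0, fun t ht => ?_⟩
  rw [hpos t ht, hpos 0 le_rfl]
  ring

theorem orbit_eq_of_entry {α : ℝ} {z z' : Surface} {n : ℤ}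
    (h : (lineMap α ^ n) (entry α z) = entry α z') (hz' : Int.fract z'.1.1 = 0) :
    orbit α z = orbit α z' := by
  have e : flow α (((n : ℝ) - Int.fract z.1.1) / speedX α) z = z' := by
    rw [flow_eq α _ z (fract_add_time_mul_speedX α z n).symm]
    conv_rhs => rw [← advance_entry α z']
    simp only [Int.floor_intCast, Int.fract_intCast, h, hz']
  rw [← e, orbit_flow]

theorem lineMap_zpow_sub_natCast (α : ℝ) (s : Section) (n : ℤ) (k : ℕ) :
    (lineMap α ^ (n - k)) s = (prevLine α)^[k] ((lineMap α ^ n) s) := by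
  induction k with
  | zero => simp
  | succ k ih =>
    have e : n - ((k + 1 : ℕ) : ℤ) = n - k - 1 := by push_cast; ring
    rw [e, lineMap_zpow_sub_one, ih, Function.iterate_succ_apply']

theorem le_col_prevLine_iterate (α : ℝ) (s : Section) (k : ℕ) :
    s.1.1 - k ≤ ((prevLine α)^[k] s).1.1 := by
  induction k with
  | zero => simp
  | succ k ih =>
    rw [Function.iterate_succ_apply']
    have := le_col_prevLine α ((prevLine α)^[k] s)
    push_cast
    omega

theorem unboundedBackward_of_col {α : ℝ} {z : Surface} {n : ℤ}
    (hz : ∀ j : ℕ, ((lineMap α ^ (n + j)) (entry α z)).1.1 = j) : UnboundedBackward α z := by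
  intro hb
  have hσ := speedX_pos α
  obtain ⟨C, hC⟩ := hb.exists_norm_le
  obtain ⟨M, hM⟩ := exists_nat_gt (max C n)
  have hMC : C < M := (le_max_left _ _).trans_lt hM
  have hMn : n < M := by exact_mod_cast (le_max_right C (n : ℝ)).trans_lt hM
  obtain ⟨k, hk⟩ := exists_prevLine_iterate_col_eq α M _ (hz M)
  have hk1 := le_col_prevLine_iterate α ((lineMap α ^ (n + M)) (entry α z)) k
  rw [hk, hz M] at hk1
  rw [← lineMap_zpow_sub_natCast] at hk
  set r : ℤ := n + M - k with hr
  have hr0 : r ≤ 0 := by omega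
  have hpos := position_fst_time α z r (f := 0) (by norm_num)
  set t := ((r : ℝ) + 0 - Int.fract z.1.1) / speedX α
  have ht : t ≤ 0 := by
    refine div_nonpos_of_nonpos_of_nonneg ?_ hσ.le
    have : (r : ℝ) ≤ 0 := by exact_mod_cast hr0
    linarith [Int.fract_nonneg z.1.1]
  have h1 := (norm_fst_le _).trans (hC _ ⟨t, ht, rfl⟩)
  rw [hpos, hk, add_zero, Real.norm_eq_abs, abs_abs] at h1
  push_cast at h1
  rw [abs_of_nonpos (by have : (0 : ℝ) ≤ M := Nat.cast_nonneg M; linarith)] at h1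
  linarith

/-! ### The escape orbit -/

theorem existsUnique_escapeOrbit {α : ℝ} (hα : Irrational α)
    (hgood : ∃ᶠ n in Filter.atTop, IsGoodLevel α n)
    (hsymm : ∀ m : ℤ, ∃ᶠ j : ℕ in Filter.atTop,
      Int.fract ((2 * j + m : ℝ) * 2 ^ j / 8 * α) ∈ Ioo (1 / 4 : ℝ) (3 / 4)) :
    (∃! η : Set Surface, IsEscapeOrbit α η) ∧
      ∀ η : Set Surface, IsEscapeOrbit α η → IsOscillatingInThePast α η := by
  obtain ⟨y, hy⟩ := exists_isEscapeSeq hα hgood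
  have hlt := hy.abs_lt hα hgood
  have hent : ∀ z, EscapesForward α z → ∃ n : ℤ, ∀ j : ℕ,
      ((lineMap α ^ (n + j)) (entry α z)).1 = ((j : ℤ), y j) := by
    intro z hz
    obtain ⟨N, hN⟩ := hz.exists_col
    obtain ⟨n, y', hy', hn⟩ := exists_isEscapeSeq_of_col hN
    obtain rfl := hy.unique hα hgood hy'
    exact ⟨n, hn⟩
  set z₀ : Surface := advance α (escapePoint y hlt 0) ⟨0, le_rfl, one_pos⟩ with hz₀
  have hez₀ : entry α z₀ = escapePoint y hlt 0 := entry_advance _ _ _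
  refine ⟨⟨orbit α z₀, ⟨z₀, rfl, escapesForward_of_entry hlt hy hez₀⟩, ?_⟩, ?_⟩
  · rintro η ⟨z, rfl, hz⟩
    obtain ⟨n, hn⟩ := hent z hz
    refine orbit_eq_of_entry (n := n) ?_ (fract_advance _ _ _)
    rw [hez₀]
    have := hn 0
    rw [Nat.cast_zero, add_zero] at this
    exact Subtype.ext this
  · rintro η ⟨z₁, rfl, hz₁⟩ z ⟨t, rfl⟩
    obtain ⟨n₁, hn₁⟩ := hent z₁ hz₁
    obtain ⟨n, hn⟩ : ∃ n : ℤ, ∀ j : ℕ,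
        ((lineMap α ^ (n + j)) (entry α (flow α t z₁))).1 = ((j : ℤ), y j) := by
      refine ⟨n₁ - ⌊Int.fract z₁.1.1 + t * speedX α⌋, fun j => ?_⟩
      rw [entry_flow, ← Equiv.Perm.mul_apply, ← zpow_add, ← hn₁ j]
      congr 3
      ring
    change OscillatesBackward α (flow α t z₁)
    set z := flow α t z₁
    refine ⟨unboundedBackward_of_col fun j => by rw [hn j], fun hback => ?_⟩
    obtain ⟨N, hN⟩ := hback.exists_col
    -- By symmetry the heights in the past are opposite to those in the future, so that the orbit
    -- joins `y 0` to `-y 0`.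
    obtain ⟨n', y', hy', hn'⟩ := exists_isEscapeSeq_neg_of_col hN
    have hyy := congrFun (hy.unique hα hgood hy'.neg) 0
    obtain ⟨K, w, hw⟩ := height_lineMap_zpow α ((lineMap α ^ n) (entry α z)) (n' - n)
    have h0 := hn 0
    rw [Nat.cast_zero, add_zero] at h0
    rw [← Equiv.Perm.mul_apply, ← zpow_add, sub_add_cancel, hn', h0] at hw
    refine hy.two_mul_ne (hsymm (n - n')) K (-w) ?_
    simp only at hw hyy
    push_cast at hw ⊢
    linarith

theorem ae_irrational : ∀ᵐ α : ℝ, Irrational α :=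
  (countable_range ((↑) : ℚ → ℝ)).ae_notMem volume

theorem ae_frequently_isGoodLevel : ∀ᵐ α : ℝ, ∃ᶠ n in Filter.atTop, IsGoodLevel α n := by
  have hq : Filter.Tendsto (fun n : ℕ => (2 : ℝ) ^ n / 2) Filter.atTop Filter.atTop :=
    (tendsto_pow_atTop_atTop_of_one_lt (by norm_num)).atTop_div_const (by norm_num)
  filter_upwards [ae_frequently_fract_mem_Ioo hq (a := 1 / 8) (b := 1 / 4) (by norm_num)
    (by norm_num) (by norm_num)] with α hα
  refine hα.mono fun n hn => ?_
  rw [IsGoodLevel, ← mul_div_assoc, mul_div_right_comm]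
  exact hn

theorem ae_frequently_fract_mul_mem (m : ℤ) : ∀ᵐ α : ℝ, ∃ᶠ j : ℕ in Filter.atTop,
    Int.fract ((2 * j + m : ℝ) * 2 ^ j / 8 * α) ∈ Ioo (1 / 4 : ℝ) (3 / 4) := by
  refine ae_frequently_fract_mem_Ioo (q := fun j : ℕ => (2 * j + m : ℝ) * 2 ^ j / 8) ?_
    (by norm_num) (by norm_num) (by norm_num)
  have h1 : Filter.Tendsto (fun j : ℕ => (2 * j + m : ℝ)) Filter.atTop Filter.atTop :=
    Filter.tendsto_atTop_add_const_right _ _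
      (tendsto_natCast_atTop_atTop.const_mul_atTop (by norm_num))
  exact (h1.atTop_mul_atTop₀
    (tendsto_pow_atTop_atTop_of_one_lt (by norm_num))).atTop_div_const (by norm_num)

end StepBilliard

theorem theorem3 :
    ∀ᵐ α : ℝ ∂(volume.restrict (Ioi 0)),
      (∃! η : Set StepBilliard.Surface, StepBilliard.IsEscapeOrbit α η) ∧
        ∀ η : Set StepBilliard.Surface, StepBilliard.IsEscapeOrbit α η →
          StepBilliard.IsOscillatingInThePast α η := by
  refine ae_restrict_of_ae ?_
  filter_upwards [StepBilliard.ae_irrational, StepBilliard.ae_frequently_isGoodLevel,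
    ae_all_iff.2 StepBilliard.ae_frequently_fract_mul_mem] with α h1 h2 h3
  exact StepBilliard.existsUnique_escapeOrbit h1 h2 h3
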